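/- Let $\alpha\in(1,2)$. Let $(V_n)_{n\ge1}$ be iid uniform on $(0,1)$ and let $(\ell_n)_{n\ge1}$ be the uniform stick-breaking process on $[0,1]$: $L_0=1$, $\ell_n=V_nL_{n-1}$, $L_n=L_{n-1}-\ell_n$ for $n\ge1$. Let $(S_\alpha^{(n)})_{n\ge1}$ be an iid sequence, independent of $(\ell_n)_{n\ge1}$, whose common law is a (non-degenerate) $\alpha$-stable law on $\mathbb R$, i.e. it is not a point mass and for all $a,b>0$ there is $d\in\mathbb R$ such that $aS_\alpha^{(1)}+bS_\alpha^{(2)}$ has the law of $(a^\alpha+b^\alpha)^{1/\alpha}S_\alpha^{(1)}+d$. Then the series $$Q=\frac12\sum_{n=1}^\infty \ell_n^{2/\alpha-1}\big(S_\alpha^{(n)}\big)^2$$ converges almost surely, the limits $$c_\pm=\lim_{x\to\infty}\frac{\mathbb P\big(\pm S_\alpha^{(1)}>\sqrt x\big)}{x^{-\alpha/2}}\in[0,\infty)$$ exist and satisfy $c_++c_->0$, and $$\lim_{x\to\infty}\frac{\mathbb P(Q>x)}{\mathbb P\big((S_\alpha^{(1)})^2>x\big)}=\lim_{x\to\infty}\frac{\mathbb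 P(Q>x)}{(c_++c_-)\,x^{-\alpha/2}}=\frac{2^{1-\alpha/2}}{2-\alpha}.$$ -/

import Mathlib

open MeasureTheory ProbabilityTheory Filter Topology

/-- A (non-degenerate) `α`-stable law on the real line: a probability measure `ν`, not a point mass,
such that for independent `X`, `Y` with law `ν` and all `a, b > 0` the sum `a X + b Y` has the law
of `(a ^ α + b ^ α) ^ (1 / α) X + d` for some real constant `d`. -/
structure IsStableLaw (α : ℝ) (ν : Measure ℝ) : Prop where
  isProbabilityMeasure : IsProbabilityMeasure ν
  ne_dirac : ∀ m : ℝ, ν ≠ Measure.dirac m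
  stable : ∀ a b : ℝ, 0 < a → 0 < b → ∃ d : ℝ,
    Measure.conv (ν.map (fun x => a * x)) (ν.map (fun x => b * x)) =
      ν.map (fun x => (a ^ α + b ^ α) ^ (1 / α) * x + d)

/-- Stick-remainders: `L 0 = 1`, and the piece `v n * L n` is broken off to leave `L (n + 1)`. -/
def stickRemainder (v : ℕ → ℝ) : ℕ → ℝ
  | 0 => 1
  | n + 1 => stickRemainder v n - v n * stickRemainder v n

/-- Length of the `n`-th piece broken off the unit stick, counted from `n = 0`. -/
def stickLength (v : ℕ → ℝ) (n : ℕ) : ℝ := v n * stickRemainder v n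

/-- `ℓ` is a uniform stick-breaking process on `[0, 1]` (indexed from `0`): it is obtained by
breaking the unit stick according to an i.i.d. sequence of uniform variables on `(0, 1)`. -/
def IsUniformStickBreaking {Ω : Type*} [MeasurableSpace Ω] (P : Measure Ω)
    (ℓ : ℕ → Ω → ℝ) : Prop :=
  ∃ V : ℕ → Ω → ℝ, (∀ n, Measurable (V n)) ∧ iIndepFun V P ∧
    (∀ n, pdf.IsUniform (V n) (Set.Ioo 0 1) P volume) ∧
    ∀ n ω, ℓ n ω = stickLength (fun k => V k ω) n

/-- The series `(1 / 2) ∑ ℓ_n ^ (2 / α - 1) (S_n) ^ 2`. -/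
noncomputable def stickSeries {Ω : Type*} (α : ℝ) (ℓ S : ℕ → Ω → ℝ) (ω : Ω) : ℝ :=
  1 / 2 * ∑' n, (ℓ n ω) ^ (2 / α - 1) * (S n ω) ^ 2

/-! Put `κ = α / 2`, `W n = ℓ_n ^ (2 / α - 1)` and `T n = S_n ^ 2`. The `T n` are nonnegative with
tail `(a + b) x ^ (-κ)`, where `a` and `b` are the tail constants of the stable law. A large value
of `∑ W n * T n` comes from one large term, so its tail should be `(a + b) x ^ (-κ) ∑ E[W n ^ κ]`.
Here `W n ^ κ = ℓ_n ^ θ` with `θ = 1 - α / 2`. Counting from `n = 0`, `ℓ_n` is a product of `n + 1`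
independent uniform variables, so `E[ℓ_n ^ θ] = (θ + 1)⁻¹ ^ (n + 1)`, and these moments sum to `1 /
θ`. The prefactor `1 / 2` of `Q` contributes `2 ^ (-κ)`, and `2 ^ (-α / 2) / (1 - α / 2)` is the
stated constant.

Since `κ < 1`, the one-big-jump heuristic can be proved with Laplace transforms
(`weighted_sum_tail`). Given the weights, the transform of the sum is a product, and `1 - ∏ (1 -
a_n)` is `∑ a_n` up to a quadratic error. `laplace_of_tail` (Abelian) supplies the asymptotics of
each factor, and `tail_of_laplace` (Karamata) turns the result back into a tail.

The stable tails are derived from the definition (`IsStableLaw.exists_tendsto_tails`). The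
functional equation gives `charFun ν t = exp (p t ^ α + i m t)` for `t ≥ 0`, with `p.re < 0`. After
centring, the exponent is homogeneous, and Lévy continuity applied to the rescaled laws tilted by `1
- sinc` gives vague convergence away from `0`, hence limits for both tails. They cannot both vanish
because `α < 2`. -/

/-! ### Characteristic functions of stable laws -/

/-- A continuous function on `[0, ∞)` that is additive there is linear there. -/
theorem eq_mul_of_additive_on_nonneg {h : ℝ → ℂ} (hc : ContinuousOn h (Set.Ici 0))
    (hadd : ∀ x y, 0 ≤ x → 0 ≤ y → h (x + y) = h x + h y) {x : ℝ} (hx : 0 ≤ x) :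
    h x = x * h 1 := by
  have h0 : h 0 = 0 := by simpa using hadd 0 0 le_rfl le_rfl
  -- The odd extension of `h` is additive on the whole line, where continuity makes it real-linear.
  let k : ℝ →+ ℂ :=
    { toFun := fun x => h (max x 0) - h (max (-x) 0)
      map_zero' := by simp
      map_add' := fun x y => by
        have e1 := hadd (max (x + y) 0) (max (-x) 0 + max (-y) 0) (by positivity) (by positivity)
        have e2 := hadd (max (-(x + y)) 0) (max x 0 + max y 0) (by positivity) (by positivity)
        have e3 : max (x + y) 0 + (max (-x) 0 + max (-y) 0)
            = max (-(x + y)) 0 + (max x 0 + max y 0) := by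
          have (z : ℝ) : max z 0 = z + max (-z) 0 := by
            rcases le_total z 0 with hz | hz
            · rw [max_eq_right hz, max_eq_left (by linarith)]; ring
            · rw [max_eq_left hz, max_eq_right (by linarith)]; ring
          rw [this (x + y), this x, this y]; ring
        rw [e3, e2, hadd (max x 0) (max y 0) (by positivity) (by positivity),
          hadd (max (-x) 0) (max (-y) 0) (by positivity) (by positivity)] at e1
        linear_combination -e1 }
  have hk : Continuous k := by
    have (f : ℝ → ℝ) (hf : Continuous f) : Continuous fun x => h (max (f x) 0) :=
      hc.comp_continuous (by fun_prop) (fun x => by simp)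
    exact (this _ continuous_id).sub (this _ continuous_neg)
  have e := (k.toRealLinearMap hk).map_smul x 1
  have ek (y : ℝ) : (k.toRealLinearMap hk) y = h (max y 0) - h (max (-y) 0) := rfl
  rw [smul_eq_mul, mul_one, ek, ek] at e
  simpa [hx, h0] using e

/-- A continuous function on the line with values in the kernel of `exp` that vanishes at `0`
vanishes identically. -/
theorem eq_zero_of_exp_eq_one {f : ℝ → ℂ} (hf : Continuous f) (h0 : f 0 = 0)
    (he : ∀ t, Complex.exp (f t) = 1) (t : ℝ) : f t = 0 := by
  have := Complex.isCoveringMap_exp.eq_of_comp_eq (A := ℝ) hf (continuous_const (y := (0 : ℂ)))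
    (by ext t; simp [he]) 0 (by simpa using h0)
  exact congrFun this t

/-- Solutions of the functional equation of the exponent of a stable law. -/
theorem stable_exponent_form {α : ℝ} (hα : 1 < α) {Ψ : ℝ → ℂ} (hΨ : Continuous Ψ) (h0 : Ψ 0 = 0)
    (h : ∀ a b : ℝ, 0 < a → 0 < b → ∃ d : ℝ, ∀ t : ℝ,
      Ψ (a * t) + Ψ (b * t) = Ψ ((a ^ α + b ^ α) ^ (1 / α) * t) + d * t * Complex.I) :
    ∃ (p : ℂ) (m : ℝ), ∀ t : ℝ, 0 ≤ t → Ψ t = p * (t ^ α : ℝ) + m * t * Complex.I := by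
  have hα0 : 0 < α := by linarith
  have hi : 0 < 1 / α := by positivity
  -- In the variable `u = t ^ α` the scale `(a ^ α + b ^ α) ^ (1 / α)` becomes plain addition.
  set g : ℝ → ℂ := fun u => Ψ (u ^ (1 / α)) with hg
  have hgc : Continuous g := hΨ.comp (Real.continuous_rpow_const hi.le)
  have hg0 : g 0 = 0 := by simp only [hg, Real.zero_rpow hi.ne', h0]
  have key : ∀ A B : ℝ, 0 ≤ A → 0 ≤ B → ∃ d : ℝ, ∀ u : ℝ, 0 ≤ u →
      g (A * u) + g (B * u) = g ((A + B) * u) + d * (u ^ (1 / α) : ℝ) * Complex.I := by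
    intro A B hA hB
    rcases hA.eq_or_lt with rfl | hA
    · exact ⟨0, fun u _ => by simp [hg0]⟩
    rcases hB.eq_or_lt with rfl | hB
    · exact ⟨0, fun u _ => by simp [hg0]⟩
    obtain ⟨d, hd⟩ := h (A ^ (1 / α)) (B ^ (1 / α)) (by positivity) (by positivity)
    refine ⟨d, fun u hu => ?_⟩
    have := hd (u ^ (1 / α))
    have e (x : ℝ) (hx : 0 < x) : (x ^ (1 / α)) ^ α = x := by
      rw [← Real.rpow_mul hx.le, one_div_mul_cancel hα0.ne', Real.rpow_one]
    rw [e A hA, e B hB, ← Real.mul_rpow hA.le hu, ← Real.mul_rpow hB.le hu,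
      ← Real.mul_rpow (by positivity) hu] at this
    exact this
  -- Eliminating `d` through its value at `u = 1` leaves a function additive in `A`.
  have hlin : ∀ u A : ℝ, 0 ≤ u → 0 ≤ A →
      g (A * u) - (u ^ (1 / α) : ℝ) * g A = A * (g u - (u ^ (1 / α) : ℝ) * g 1) := by
    intro u A hu hA
    have := eq_mul_of_additive_on_nonneg (h := fun A => g (A * u) - (u ^ (1 / α) : ℝ) * g A)
      (by fun_prop) (fun x y hx hy => ?_) hA
    · simpa using this
    · obtain ⟨d, hd⟩ := key x y hx hy
      have e1 := hd 1 zero_le_one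
      have eu := hd u hu
      simp only [mul_one, Real.one_rpow, Complex.ofReal_one] at e1
      linear_combination (u ^ (1 / α) : ℝ) * e1 - eu
  set D : ℝ := 2 ^ (1 / α) - 2 with hD
  have hDne : D < 0 := by
    have : (2 : ℝ) ^ (1 / α) < 2 ^ (1 : ℝ) :=
      Real.rpow_lt_rpow_of_exponent_lt (by norm_num) (by rw [div_lt_one hα0]; exact hα)
    rw [Real.rpow_one] at this
    linarith
  have hDC : (D : ℂ) ≠ 0 := by exact_mod_cast hDne.ne
  -- Taking `hlin` at `(2, A)` and at `(A, 2)` gives two expressions for `g (2 * A)`. Equating them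
  -- determines `g A`, because the coefficient `D` is nonzero.
  obtain ⟨p, q, hpq⟩ : ∃ p q : ℂ, ∀ A : ℝ, 0 ≤ A → g A = p * A + q * (A ^ (1 / α) : ℝ) := by
    refine ⟨(-g 2 + g 1 * (2 ^ (1 / α) : ℝ)) / D, (g 2 - 2 * g 1) / D, fun A hA => ?_⟩
    have e1 := hlin 2 A zero_le_two hA
    have e2 := hlin A 2 hA zero_le_two
    rw [mul_comm 2 A] at e2
    field_simp
    rw [hD]
    push_cast at e1 e2 ⊢
    linear_combination e2 - e1
  -- The shift `d` is real, so real parts at `A = B = u = 1` force `q.re * D = 0`; the second term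
  -- is a pure drift.
  have hq : q.re = 0 := by
    obtain ⟨d, hd⟩ := key 1 1 zero_le_one zero_le_one
    have e := hd 1 zero_le_one
    have e11 : (1 + 1 : ℝ) * 1 = 2 := by norm_num
    rw [e11, mul_one, hpq 1 zero_le_one, hpq 2 zero_le_two] at e
    have e' := congrArg Complex.re e
    simp only [Complex.add_re, Complex.mul_re, Complex.ofReal_re, Complex.ofReal_im,
      Complex.I_re, Complex.I_im, Real.one_rpow, Complex.mul_im] at e'
    have : q.re * D = 0 := by rw [hD]; linear_combination -e'
    exact (mul_eq_zero.1 this).resolve_right hDne.ne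
  refine ⟨p, q.im, fun t ht => ?_⟩
  have e := hpq (t ^ α) (by positivity)
  have et : (t ^ α) ^ (1 / α) = t := by
    rw [← Real.rpow_mul ht, mul_one_div_cancel hα0.ne', Real.rpow_one]
  simp only [hg, et] at e
  rw [e, ← Complex.re_add_im q, hq]
  simp
  ring

/-- The symmetrisation of `ν` has characteristic function `‖charFun ν‖ ^ 2 = 1`, so it is the point
mass at `0`. By Fubini, some fixed `x` then equals almost every `y`. -/
theorem charFun_eq_one_norm_imp_dirac {ν : Measure ℝ} [IsProbabilityMeasure ν]
    (h : ∀ t, ‖charFun ν t‖ = 1) : ∃ m, ν = Measure.dirac m := by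
  set ρ : Measure ℝ := Measure.conv ν (ν.map (fun x => -1 * x)) with hρ
  have : IsProbabilityMeasure (ν.map (fun x : ℝ => -1 * x)) :=
    Measure.isProbabilityMeasure_map (by fun_prop)
  have hd : ρ = Measure.dirac 0 := by
    apply Measure.ext_of_charFun
    ext t
    rw [hρ, charFun_conv, charFun_map_mul, charFun_dirac, neg_one_mul, charFun_neg,
      Complex.mul_conj, Complex.normSq_eq_norm_sq, h]
    simp
  have h1 : ∀ᵐ z ∂ρ, z = 0 := by
    rw [hd, ae_dirac_eq]; rfl
  rw [hρ, Measure.conv, ae_map_iff (p := fun z : ℝ => z = 0) (by fun_prop)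
    (measurableSet_singleton (0 : ℝ))] at h1
  have h2 := Measure.ae_ae_of_ae_prod h1
  obtain ⟨x, hx⟩ := h2.exists
  rw [ae_map_iff (by fun_prop) (measurableSet_eq_fun (by fun_prop) (by fun_prop))] at hx
  refine ⟨x, ?_⟩
  have hx' : ∀ᵐ y ∂ν, id y = (fun _ => x) y := by
    filter_upwards [hx] with y hy
    simp only [id]; linarith
  have e : ν.map id = ν.map (fun _ => x) := Measure.map_congr hx'
  simpa using e

/-- The characteristic function of a stable law with index `α > 1`. -/
theorem IsStableLaw.exists_charFun_eq {α : ℝ} (hα : 1 < α) {ν : Measure ℝ}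
    (hν : IsStableLaw α ν) :
    ∃ (p : ℂ) (m : ℝ), p.re < 0 ∧ ∀ t : ℝ, 0 ≤ t →
      charFun ν t = Complex.exp (p * (t ^ α : ℝ) + m * t * Complex.I) := by
  have := hν.isProbabilityMeasure
  have hα0 : 0 < α := by linarith
  set φ := charFun ν with hφ
  have hcont : Continuous φ := by rw [hφ]; fun_prop
  have h0 : φ 0 = 1 := by simp [hφ]
  have hfe : ∀ a b : ℝ, 0 < a → 0 < b → ∃ d : ℝ, ∀ t : ℝ,
      φ (a * t) * φ (b * t)
        = φ ((a ^ α + b ^ α) ^ (1 / α) * t) * Complex.exp (d * t * Complex.I) := by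
    intro a b ha hb
    obtain ⟨d, hd⟩ := hν.stable a b ha hb
    refine ⟨d, fun t => ?_⟩
    have e := congrArg (fun μ => charFun μ t) hd
    have : IsProbabilityMeasure (ν.map (fun x : ℝ => a * x)) :=
      Measure.isProbabilityMeasure_map (by fun_prop)
    have : IsProbabilityMeasure (ν.map (fun x : ℝ => b * x)) :=
      Measure.isProbabilityMeasure_map (by fun_prop)
    have e2 : ν.map (fun x => (a ^ α + b ^ α) ^ (1 / α) * x + d)
        = (ν.map (fun x => (a ^ α + b ^ α) ^ (1 / α) * x)).map (· + d) := by
      rw [Measure.map_map (by fun_prop) (by fun_prop)]; rfl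
    simp only [charFun_conv, charFun_map_mul, e2, charFun_map_add_const] at e
    rw [hφ, e]
    simp [mul_comm]
  -- With `a = b = 1`, a zero at `t` propagates to `t / c ^ k` with `c > 1`. These points tend to
  -- `0`, where `φ = 1`.
  have hne : ∀ t, φ t ≠ 0 := by
    intro t ht
    obtain ⟨d, hd⟩ := hfe 1 1 one_pos one_pos
    set c : ℝ := (1 ^ α + 1 ^ α) ^ (1 / α) with hc
    have hc1 : 1 < c := by
      rw [hc, Real.one_rpow]; exact Real.one_lt_rpow (by norm_num) (by positivity)
    have hk : ∀ k : ℕ, φ (t * (c⁻¹) ^ k) = 0 := by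
      intro k
      induction k with
      | zero => simpa using ht
      | succ k ih =>
        have e := hd (t * (c⁻¹) ^ (k + 1))
        have : c * (t * (c⁻¹) ^ (k + 1)) = t * (c⁻¹) ^ k := by
          have : c ≠ 0 := by positivity
          rw [pow_succ]; field_simp
        rw [this, ih, zero_mul, one_mul] at e
        exact mul_self_eq_zero.1 e
    have hl : Tendsto (fun k : ℕ => φ (t * (c⁻¹) ^ k)) atTop (𝓝 (φ (t * 0))) :=
      (hcont.tendsto _).comp ((tendsto_pow_atTop_nhds_zero_of_lt_one (by positivity)
        (inv_lt_one_of_one_lt₀ hc1)).const_mul t)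
    simp only [hk, mul_zero, h0] at hl
    exact zero_ne_one (tendsto_nhds_unique tendsto_const_nhds hl)
  have hU : IsSimplyConnected (Set.univ : Set ℝ) := by
    have := (convex_univ (𝕜 := ℝ) (E := ℝ)).contractibleSpace Set.univ_nonempty
    exact SimplyConnectedSpace.ofContractible _
  -- The line is simply connected, so the nonvanishing `φ` has a continuous logarithm.
  obtain ⟨f, hfc, hf⟩ := Complex.exists_continuousOn_eqOn_exp_comp (X := ℝ) (U := Set.univ)
    (g := φ) hU isOpen_univ hcont.continuousOn
    (by rintro ⟨t, -, ht⟩; exact hne t ht)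
  rw [continuousOn_univ] at hfc
  have hf0 : Complex.exp (f 0) = 1 := by rw [← h0]; exact hf (Set.mem_univ 0)
  set Ψ : ℝ → ℂ := fun t => f t - f 0 with hΨ
  have hΨc : Continuous Ψ := by fun_prop
  have hΨe : ∀ t, Complex.exp (Ψ t) = φ t := fun t => by
    rw [hΨ, Complex.exp_sub, hf0, div_one]; exact hf (Set.mem_univ t)
  have hΨ0 : Ψ 0 = 0 := by simp [hΨ]
  obtain ⟨p, m, hpm⟩ := stable_exponent_form hα hΨc hΨ0 (by
    intro a b ha hb
    obtain ⟨d, hd⟩ := hfe a b ha hb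
    refine ⟨d, fun t => ?_⟩
    -- The equation for `φ` gives the one for `Ψ` modulo `2πi`; continuity and the value at `0`
    -- remove the ambiguity.
    have := eq_zero_of_exp_eq_one
      (f := fun t : ℝ => Ψ (a * t) + Ψ (b * t)
        - (Ψ ((a ^ α + b ^ α) ^ (1 / α) * t) + d * t * Complex.I)) (by fun_prop)
      (by simp [hΨ0]) (fun t => by
        simp only [Complex.exp_sub, Complex.exp_add, hΨe, hd]
        exact div_self (mul_ne_zero (hne _) (Complex.exp_ne_zero _))) t
    exact sub_eq_zero.1 this)
  have hnorm : ∀ t : ℝ, 0 ≤ t → ‖φ t‖ = Real.exp (p.re * t ^ α) := fun t ht => by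
    rw [← hΨe, hpm t ht, Complex.norm_exp]
    simp
  refine ⟨p, m, ?_, fun t ht => by rw [← hpm t ht, hΨe]⟩
  have hle : p.re ≤ 0 := by
    have := hnorm 1 zero_le_one
    have h1 : ‖φ 1‖ ≤ 1 := norm_charFun_le_one _
    rw [this] at h1
    simpa using h1
  refine hle.lt_of_ne fun hp => ?_
  obtain ⟨x, hx⟩ := charFun_eq_one_norm_imp_dirac (ν := ν) (fun t => by
    have h1 : ∀ t, 0 ≤ t → ‖φ t‖ = 1 := fun t ht => by simp [hnorm t ht, hp]
    rcases le_total 0 t with ht | ht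
    · exact h1 t ht
    · have := h1 (-t) (by linarith)
      rwa [hφ, charFun_neg, RCLike.norm_conj] at this)
  exact hν.ne_dirac x hx

/-! ### Vague convergence of the rescaled laws -/

/-- A pointwise limit of characteristic functions which is continuous at `0` is a characteristic
function. -/
theorem exists_charFun_eq_of_tendsto {μ : ℕ → ProbabilityMeasure ℝ} {f : ℝ → ℂ}
    (hf : ContinuousAt f 0)
    (h : ∀ t, Tendsto (fun n => charFun (μ n : Measure ℝ) t) atTop (𝓝 (f t))) :
    ∃ μ₀ : ProbabilityMeasure ℝ, ∀ t, charFun (μ₀ : Measure ℝ) t = f t := by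
  have h_tight : IsTightMeasureSet {((μ n : ProbabilityMeasure ℝ) : Measure ℝ) | n} :=
    isTightMeasureSet_of_tendsto_charFun hf h
  have h_compact : IsCompact (closure {μ n | n}) :=
    isCompact_closure_of_isTightMeasureSet (by simpa using h_tight)
  -- A limit along an ultrafilter replaces the extraction of a subsequence; the characteristic
  -- functions already converge along `atTop`.
  let U : Ultrafilter ℕ := Ultrafilter.of atTop
  obtain ⟨μ', -, hμ'⟩ := h_compact.ultrafilter_le_nhds (U.map μ)
    (.trans (by simp) (monotone_principal subset_closure))
  have hμ'' : Tendsto μ U (𝓝 μ') := hμ'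
  refine ⟨μ', fun t => ?_⟩
  rw [ProbabilityMeasure.tendsto_iff_forall_integral_rclike_tendsto ℂ] at hμ''
  have e := hμ'' (BoundedContinuousFunction.innerProbChar t)
  simp only [← charFun_eq_integral_innerProbChar] at e
  exact tendsto_nhds_unique e ((h t).mono_left (Ultrafilter.of_le _))

theorem integrable_exp_mul_I (P : Measure ℝ) [IsFiniteMeasure P] (t : ℝ) :
    Integrable (fun x : ℝ => Complex.exp (t * x * Complex.I)) P := by
  refine (integrable_const (1 : ℝ)).mono' (by fun_prop) (ae_of_all _ fun x => ?_)
  rw [← Complex.ofReal_mul, Complex.norm_exp_ofReal_mul_I]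

/-- `sinc x` is the mean of `exp (i h x)` over `h ∈ [-1, 1]`, so weighting by `sinc` averages
translates of the characteristic function. -/
theorem integral_exp_mul_sinc (P : Measure ℝ) [IsProbabilityMeasure P] (t : ℝ) :
    ∫ x, Complex.exp (t * x * Complex.I) * (Real.sinc x : ℂ) ∂P
      = 1 / 2 * ∫ h in (-1 : ℝ)..1, charFun P (t + h) := by
  have hs (x : ℝ) : (Real.sinc x : ℂ)
      = 1 / 2 * ∫ h in (-1 : ℝ)..1, Complex.exp (h * x * Complex.I) := by
    have := integral_charFun_Icc (μ := Measure.dirac x) one_pos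
    simp only [charFun_apply_real, integral_dirac, one_mul] at this
    rw [this]; push_cast; ring
  have : IsFiniteMeasure ((volume : Measure ℝ).restrict (Set.uIoc (-1) 1)) := ⟨by simp⟩
  have hi : Integrable (Function.uncurry fun (h x : ℝ) =>
      Complex.exp ((t + h : ℝ) * x * Complex.I)) ((volume.restrict (Set.uIoc (-1) 1)).prod P) := by
    refine (integrable_const (1 : ℝ)).mono' (by fun_prop) (ae_of_all _ fun x => ?_)
    rw [Function.uncurry_def]
    beta_reduce
    rw [← Complex.ofReal_mul, Complex.norm_exp_ofReal_mul_I]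
  simp only [hs, charFun_apply_real]
  rw [intervalIntegral_integral_swap hi, ← integral_const_mul]
  congr 1
  ext x
  rw [mul_left_comm, ← intervalIntegral.integral_const_mul]
  congr 2 with h
  rw [← Complex.exp_add]
  congr 1; push_cast; ring

/-- The weight `1 - sinc` is nonnegative, bounded and quadratically small at `0`. It damps the mass
that the rescaled laws accumulate there, while the Fourier transform stays computable. -/
theorem integral_exp_mul_one_sub_sinc (P : Measure ℝ) [IsProbabilityMeasure P] (t : ℝ) :
    ∫ x, Complex.exp (t * x * Complex.I) * ((1 - Real.sinc x : ℝ) : ℂ) ∂P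
      = 1 / 2 * ∫ h in (-1 : ℝ)..1, (charFun P t - charFun P (t + h)) := by
  have h2 : Integrable (fun x : ℝ => Complex.exp (t * x * Complex.I) * (Real.sinc x : ℂ)) P := by
    refine (integrable_const (1 : ℝ)).mono'
      (by have := Real.continuous_sinc; fun_prop) (ae_of_all _ fun x => ?_)
    rw [norm_mul, ← Complex.ofReal_mul, Complex.norm_exp_ofReal_mul_I, one_mul, Complex.norm_real]
    exact Real.abs_sinc_le_one x
  have hc : Continuous (charFun P) := by fun_prop
  rw [intervalIntegral.integral_sub (by simp) ((by fun_prop : Continuous _).intervalIntegrable _ _),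
    mul_sub, ← integral_exp_mul_sinc]
  have (x : ℝ) : Complex.exp (t * x * Complex.I) * ((1 - Real.sinc x : ℝ) : ℂ)
      = Complex.exp (t * x * Complex.I) - Complex.exp (t * x * Complex.I) * (Real.sinc x : ℂ) := by
    push_cast; ring
  simp only [this]
  rw [integral_sub (integrable_exp_mul_I P t) h2, ← charFun_apply_real]
  simp
  ring

theorem integrable_one_sub_sinc (P : Measure ℝ) [IsFiniteMeasure P] :
    Integrable (fun x => 1 - Real.sinc x) P := by
  refine (integrable_const (2 : ℝ)).mono'
    (by have := Real.continuous_sinc; fun_prop) (ae_of_all _ fun x => ?_)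
  have := abs_le.1 (Real.abs_sinc_le_one x)
  rw [Real.norm_eq_abs, abs_le]; constructor <;> linarith

theorem one_sub_sinc_nonneg (x : ℝ) : 0 ≤ 1 - Real.sinc x := by
  have := abs_le.1 (Real.abs_sinc_le_one x); linarith

/-- The measure `P` reweighted by `1 - sinc` and normalised. -/
noncomputable def sincTilt (P : Measure ℝ) : Measure ℝ :=
  P.withDensity fun x => ENNReal.ofReal ((1 - Real.sinc x) / ∫ y, (1 - Real.sinc y) ∂P)

theorem isProbabilityMeasure_sincTilt (P : Measure ℝ) [IsFiniteMeasure P]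
    (h : 0 < ∫ y, (1 - Real.sinc y) ∂P) : IsProbabilityMeasure (sincTilt P) := by
  constructor
  rw [sincTilt, withDensity_apply _ MeasurableSet.univ, Measure.restrict_univ,
    ← ofReal_integral_eq_lintegral_ofReal ((integrable_one_sub_sinc P).div_const _)
      (ae_of_all _ fun x => div_nonneg (one_sub_sinc_nonneg x) h.le), integral_div,
    div_self h.ne', ENNReal.ofReal_one]

theorem integral_sincTilt {E : Type*} [NormedAddCommGroup E] [NormedSpace ℝ E]
    (P : Measure ℝ) (f : ℝ → E) :
    ∫ x, f x ∂(sincTilt P)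
      = (∫ y, (1 - Real.sinc y) ∂P)⁻¹ • ∫ x, (1 - Real.sinc x) • f x ∂P := by
  have hm : 0 ≤ ∫ y, (1 - Real.sinc y) ∂P := integral_nonneg one_sub_sinc_nonneg
  rw [sincTilt, integral_withDensity_eq_integral_toReal_smul
    (by have := Real.continuous_sinc; fun_prop) (ae_of_all _ fun x => ENNReal.ofReal_lt_top),
    ← integral_smul]
  congr 1 with x
  rw [ENNReal.toReal_ofReal (div_nonneg (one_sub_sinc_nonneg x) hm), div_eq_inv_mul, mul_smul]

/-- A non-degenerate homogeneous exponent: `μ` has characteristic function `exp ψ`, with `ψ`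
positively homogeneous of degree `α`. -/
structure HasHomogeneousExponent (μ : Measure ℝ) (α c : ℝ) (ψ : ℝ → ℂ) : Prop where
  charFun_eq : ∀ t, charFun μ t = Complex.exp (ψ t)
  cont : Continuous ψ
  hom : ∀ t l : ℝ, 0 < l → ψ (l⁻¹ * t) = ψ t / (l ^ α : ℝ)
  re_eq : ∀ t, (ψ t).re = -(c * |t| ^ α)
  c_pos : 0 < c
  index_pos : 0 < α

theorem norm_exp_sub_one_le_of_re_nonpos {z : ℂ} (hz : z.re ≤ 0) :
    ‖Complex.exp z - 1‖ ≤ 2 * ‖z‖ := by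
  rcases le_total ‖z‖ 1 with h | h
  · exact Complex.norm_exp_sub_one_le h
  · calc ‖Complex.exp z - 1‖ ≤ ‖Complex.exp z‖ + ‖(1 : ℂ)‖ := norm_sub_le _ _
      _ ≤ 1 + 1 := by
        gcongr
        · rw [Complex.norm_exp]; exact Real.exp_le_one_iff.2 hz
        · simp
      _ ≤ 2 * ‖z‖ := by linarith

namespace HasHomogeneousExponent

variable {μ : Measure ℝ} {α c : ℝ} {ψ : ℝ → ℂ}

theorem re_nonpos (h : HasHomogeneousExponent μ α c ψ) (t : ℝ) : (ψ t).re ≤ 0 := by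
  rw [h.re_eq]; have := h.c_pos; simp; positivity

/-- By homogeneity this is the difference quotient at `0` of `z ↦ exp (z * ψ t)`, with increment `z
= (l ^ α)⁻¹`. -/
theorem tendsto_rescaled (h : HasHomogeneousExponent μ α c ψ) (t : ℝ) :
    Tendsto (fun l : ℝ => ((l ^ α : ℝ) : ℂ) * (charFun μ (l⁻¹ * t) - 1)) atTop (𝓝 (ψ t)) := by
  have hd : HasDerivAt (fun z : ℝ => Complex.exp (z * ψ t)) (ψ t) 0 := by
    have := ((Complex.ofRealCLM.hasDerivAt (x := (0 : ℝ))).mul_const (ψ t)).cexp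
    simpa using this
  have h2 := hd.tendsto_slope_zero_right
  have h3 : Tendsto (fun l : ℝ => (l ^ α)⁻¹) atTop (𝓝[>] 0) :=
    tendsto_inv_atTop_nhdsGT_zero.comp (tendsto_rpow_atTop h.index_pos)
  refine (h2.comp h3).congr' ?_
  filter_upwards [eventually_gt_atTop 0] with l hl
  rw [h.charFun_eq, h.hom _ _ hl]
  simp [div_eq_inv_mul]

/-- The bound does not depend on `l`, which is what dominated convergence over `s` requires. -/
theorem norm_rescaled_le (h : HasHomogeneousExponent μ α c ψ) (t : ℝ) {l : ℝ} (hl : 0 < l) :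
    ‖((l ^ α : ℝ) : ℂ) * (charFun μ (l⁻¹ * t) - 1)‖ ≤ 2 * ‖ψ t‖ := by
  have hp : 0 < l ^ α := by positivity
  rw [h.charFun_eq, norm_mul, Complex.norm_real, Real.norm_of_nonneg hp.le]
  have := norm_exp_sub_one_le_of_re_nonpos (h.re_nonpos (l⁻¹ * t))
  calc _ ≤ l ^ α * (2 * ‖ψ (l⁻¹ * t)‖) := by gcongr
    _ = 2 * ‖ψ t‖ := by
      rw [h.hom _ _ hl, norm_div, Complex.norm_real, Real.norm_of_nonneg hp.le]
      field_simp

theorem tendsto_integral_tilt [IsProbabilityMeasure μ] (h : HasHomogeneousExponent μ α c ψ) (t : ℝ) :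
    Tendsto (fun l : ℝ => ((l ^ α : ℝ) : ℂ) *
      ∫ x, Complex.exp (t * x * Complex.I) * ((1 - Real.sinc x : ℝ) : ℂ) ∂(μ.map (l⁻¹ * ·)))
      atTop (𝓝 (1 / 2 * ∫ s in (-1 : ℝ)..1, (ψ t - ψ (t + s)))) := by
  have hcont := h.cont
  have hφ : Continuous (charFun μ) := by fun_prop
  have := intervalIntegral.tendsto_integral_filter_of_dominated_convergence
    (μ := volume) (a := -1) (b := 1) (l := atTop)
    (F := fun (l : ℝ) (s : ℝ) => ((l ^ α : ℝ) : ℂ) * (charFun μ (l⁻¹ * t) - 1)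
      - ((l ^ α : ℝ) : ℂ) * (charFun μ (l⁻¹ * (t + s)) - 1))
    (f := fun s => ψ t - ψ (t + s))
    (fun s => 2 * ‖ψ t‖ + 2 * ‖ψ (t + s)‖)
    (Eventually.of_forall fun l => by fun_prop)
    (by
      filter_upwards [eventually_gt_atTop 0] with l hl
      exact ae_of_all _ fun s _ => (norm_sub_le _ _).trans
        (add_le_add (h.norm_rescaled_le _ hl) (h.norm_rescaled_le _ hl)))
    ((by fun_prop : Continuous _).intervalIntegrable _ _)
    (ae_of_all _ fun s _ => (h.tendsto_rescaled t).sub (h.tendsto_rescaled (t + s)))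
  refine (this.const_mul (1 / 2)).congr fun l => ?_
  have : IsProbabilityMeasure (μ.map (l⁻¹ * ·)) := Measure.isProbabilityMeasure_map (by fun_prop)
  rw [integral_exp_mul_one_sub_sinc, mul_left_comm,
    ← intervalIntegral.integral_const_mul ((l ^ α : ℝ) : ℂ)]
  congr 1
  refine intervalIntegral.integral_congr (μ := volume) fun s _ => ?_
  rw [charFun_map_mul, charFun_map_mul]
  ring

/-- Vague convergence, away from `0`, of the rescaled laws. -/
theorem exists_tendsto_integral [IsProbabilityMeasure μ] (h : HasHomogeneousExponent μ α c ψ) {f : ℝ → ℝ}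
    (hf : Continuous f) (hf1 : ∀ x, |f x| ≤ 1) (hf2 : ∀ x ≤ 2, f x = 0) :
    ∃ N : ℝ, Tendsto (fun l : ℝ => l ^ α * ∫ x, f (l⁻¹ * x) ∂μ) atTop (𝓝 N) := by
  have hψ := h.cont
  set F : ℝ → ℂ := fun t => 1 / 2 * ∫ s in (-1 : ℝ)..1, (ψ t - ψ (t + s)) with hF
  have hFc : Continuous F := by
    refine continuous_const.mul
      (intervalIntegral.continuous_parametric_intervalIntegral_of_continuous' ?_ _ _)
    fun_prop
  set m : ℝ → ℝ := fun l => ∫ x, (1 - Real.sinc x) ∂(μ.map (l⁻¹ * ·)) with hm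
  have hprob (l : ℝ) : IsProbabilityMeasure (μ.map (l⁻¹ * ·)) :=
    Measure.isProbabilityMeasure_map (by fun_prop)
  have hJ0 : Tendsto (fun l : ℝ => ((l ^ α * m l : ℝ) : ℂ)) atTop (𝓝 (F 0)) := by
    refine (h.tendsto_integral_tilt 0).congr fun l => ?_
    simp [hm]
    rw [← integral_complex_ofReal]
    simp
  set M : ℝ := (F 0).re with hM
  have hmM : Tendsto (fun l : ℝ => l ^ α * m l) atTop (𝓝 M) := by
    exact (Complex.continuous_re.tendsto _).comp hJ0
  have hψ0 : ψ 0 = 0 := by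
    refine tendsto_nhds_unique (h.tendsto_rescaled 0) ?_
    simp
  -- `M` is the limiting mass of the tilted laws; nondegeneracy `c > 0` keeps it positive, so
  -- normalisation is possible.
  have hMpos : 0 < M := by
    have e : M = 1 / 2 * ∫ s in (-1 : ℝ)..1, c * |s| ^ α := by
      have : (∫ s in (-1 : ℝ)..1, -ψ s).re = ∫ s in (-1 : ℝ)..1, (-ψ s).re := by
        have := Complex.reCLM.intervalIntegral_comp_comm (μ := volume) (a := -1) (b := 1)
          (f := fun s => -ψ s) ((by fun_prop : Continuous _).intervalIntegrable _ _)
        simpa using this.symm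
      simp only [hM, hF, hψ0, zero_sub, zero_add]
      rw [show (1 / 2 : ℂ) = ((1 / 2 : ℝ) : ℂ) by push_cast; rfl, Complex.re_ofReal_mul, this]
      simp only [Complex.neg_re, h.re_eq, neg_neg]
    rw [e]
    have hα := h.index_pos
    refine mul_pos (by norm_num) (intervalIntegral.integral_pos (by norm_num) ?_ ?_ ?_)
    · exact ((continuous_abs.rpow_const fun _ => Or.inr hα.le).const_mul c).continuousOn
    · intro x _; have := h.c_pos; positivity
    · exact ⟨1, by simp, by simpa using h.c_pos⟩
  have hmpos : ∀ᶠ l in atTop, 0 < m l := by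
    filter_upwards [hmM.eventually (lt_mem_nhds hMpos), eventually_gt_atTop 0] with l h1 h2
    exact (pos_iff_pos_of_mul_pos h1).1 (by positivity)
  classical
  let Q : ℝ → ProbabilityMeasure ℝ := fun l =>
    if hl : 0 < m l then ⟨sincTilt (μ.map (l⁻¹ * ·)), isProbabilityMeasure_sincTilt _ hl⟩
    else ⟨Measure.dirac 0, inferInstance⟩
  have hQ {l : ℝ} (hl : 0 < m l) : (Q l : Measure ℝ) = sincTilt (μ.map (l⁻¹ * ·)) := by
    simp [Q, hl]
  have hQlim (t : ℝ) :
      Tendsto (fun l => charFun (Q l : Measure ℝ) t) atTop (𝓝 (F t / M)) := by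
    have h1 := (h.tendsto_integral_tilt t).div ((Complex.continuous_ofReal.tendsto _).comp hmM)
      (by exact_mod_cast hMpos.ne')
    refine h1.congr' ?_
    filter_upwards [hmpos, eventually_gt_atTop 0] with l hl hl0
    have hp : ((l ^ α : ℝ) : ℂ) ≠ 0 := by
      have : 0 < l ^ α := by positivity
      exact_mod_cast this.ne'
    rw [hQ hl, charFun_apply_real, integral_sincTilt]
    simp only [Pi.div_apply, Function.comp, Complex.ofReal_mul, Complex.real_smul]
    rw [mul_div_mul_left _ _ hp, div_eq_inv_mul, ← Complex.ofReal_inv]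
    congr 2 with x
    ring
  obtain ⟨μ₀, hμ₀⟩ := exists_charFun_eq_of_tendsto (μ := fun n : ℕ => Q n)
    (f := fun t => F t / M) (by fun_prop)
    (fun t => (hQlim t).comp tendsto_natCast_atTop_atTop)
  have hden (x : ℝ) : 1 / 2 ≤ 1 - Real.sinc (max x 2) := by
    have h2 : (2 : ℝ) ≤ max x 2 := le_max_right _ _
    rw [Real.sinc_of_ne_zero (by positivity)]
    have : Real.sin (max x 2) / max x 2 ≤ 1 / 2 := by
      rw [div_le_div_iff₀ (by positivity) (by norm_num)]
      have := Real.sin_le_one (max x 2)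
      linarith
    linarith
  -- Dividing by the weight undoes the tilt. Replacing `x` by `max x 2` keeps the denominator at
  -- least `1 / 2` and changes nothing, since `f` vanishes on `x ≤ 2`.
  let k : ℝ → ℝ := fun x => f x / (1 - Real.sinc (max x 2))
  have hk : Continuous k := by
    have := Real.continuous_sinc
    exact hf.div (by fun_prop) fun x => by linarith [hden x]
  let kb : BoundedContinuousFunction ℝ ℝ := BoundedContinuousFunction.ofNormedAddCommGroup k hk 2
    (fun x => by
      have := hden x
      rw [Real.norm_eq_abs, abs_div, abs_of_pos (by linarith : 0 < 1 - Real.sinc (max x 2)),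
        div_le_iff₀ (by linarith)]
      linarith [hf1 x])
  refine ⟨M * ∫ x, k x ∂(μ₀ : Measure ℝ), ?_⟩
  have hlim : Tendsto (fun l => ∫ x, k x ∂(Q l : Measure ℝ)) atTop
      (𝓝 (∫ x, k x ∂(μ₀ : Measure ℝ))) := by
    refine tendsto_of_seq_tendsto fun u hu => ?_
    have h1 : Tendsto (fun n => Q (u n)) atTop (𝓝 μ₀) :=
      ProbabilityMeasure.tendsto_of_tendsto_charFun fun t => by
        rw [hμ₀]; exact (hQlim t).comp hu
    exact (ProbabilityMeasure.tendsto_iff_forall_integral_tendsto.1 h1) kb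
  refine (hmM.mul hlim).congr' ?_
  filter_upwards [hmpos] with l hl
  rw [hQ hl, integral_sincTilt, smul_eq_mul, mul_assoc, ← mul_assoc (m l),
    mul_inv_cancel₀ hl.ne', one_mul]
  have : ∀ x, (1 - Real.sinc x) • k x = f x := fun x => by
    rcases le_total x 2 with hx | hx
    · simp [k, hf2 x hx]
    · have := hden x
      simp only [k, max_eq_left hx, smul_eq_mul] at this ⊢
      field_simp
  simp only [this]
  rw [integral_map (by fun_prop) hf.aestronglyMeasurable]

end HasHomogeneousExponent

/-! ### Power tails of stable laws -/

/-- A nonnegative function which is, up to factors arbitrarily close to `1`, asymptotically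
constant converges. -/
theorem exists_tendsto_of_approx {U : ℝ → ℝ} (hU : ∀ x, 0 < x → 0 ≤ U x)
    (h : ∀ r : ℝ, 1 < r → ∃ N : ℝ, ∀ η > 0, ∀ᶠ x in atTop, N - η ≤ U x ∧ U x ≤ r * N + η) :
    ∃ c : ℝ, 0 ≤ c ∧ Tendsto U atTop (𝓝 c) := by
  have hnn : ∀ᶠ x in atTop, 0 ≤ U x := by
    filter_upwards [eventually_gt_atTop 0] with x hx using hU x hx
  have hbelow : IsBoundedUnder (· ≥ ·) atTop U := ⟨0, hnn⟩
  have habove : IsBoundedUnder (· ≤ ·) atTop U := by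
    obtain ⟨N, hN⟩ := h 2 one_lt_two
    exact ⟨2 * N + 1, (hN 1 one_pos).mono fun x hx => hx.2⟩
  -- The two bounds read `N ≤ liminf` and `limsup ≤ r * N`; afterwards `r` decreases to `1`.
  have hle : ∀ r : ℝ, 1 < r → limsup U atTop ≤ r * liminf U atTop := by
    intro r hr
    obtain ⟨N, hN⟩ := h r hr
    have h1 : N ≤ liminf U atTop := le_of_forall_sub_le fun η hη =>
      le_liminf_of_le habove.isCoboundedUnder_ge ((hN η hη).mono fun x hx => hx.1)
    have h2 : limsup U atTop ≤ r * N := le_of_forall_pos_le_add fun η hη =>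
      limsup_le_of_le hbelow.isCoboundedUnder_le ((hN η hη).mono fun x hx => hx.2)
    exact h2.trans (by gcongr)
  have hfin : limsup U atTop ≤ liminf U atTop := by
    have ht : Tendsto (fun r : ℝ => r * liminf U atTop) (𝓝[>] 1) (𝓝 (1 * liminf U atTop)) :=
      ((continuous_mul_const _).tendsto 1).mono_left nhdsWithin_le_nhds
    rw [one_mul] at ht
    exact ge_of_tendsto ht (eventually_nhdsWithin_of_forall fun r hr => hle r hr)
  have hl : Tendsto U atTop (𝓝 (liminf U atTop)) :=
    tendsto_of_le_liminf_of_limsup_le le_rfl hfin habove hbelow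
  exact ⟨_, ge_of_tendsto hl hnn, hl⟩

namespace HasHomogeneousExponent

variable {μ : Measure ℝ} {α c : ℝ} {ψ : ℝ → ℂ}

/-- A continuous ramp between the levels `2` and `2 * (1 + ε)` is sandwiched between two indicators.
Vague convergence therefore fixes the tail up to the factor `(1 + ε) ^ α = r`. -/
theorem exists_tendsto_tail [IsProbabilityMeasure μ] (h : HasHomogeneousExponent μ α c ψ) :
    ∃ k : ℝ, 0 ≤ k ∧ Tendsto (fun x : ℝ => x ^ α * μ.real (Set.Ioi x)) atTop (𝓝 k) := by
  have hα := h.index_pos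
  refine exists_tendsto_of_approx (fun x hx => by positivity) fun r hr => ?_
  set ε : ℝ := r ^ (1 / α) - 1 with hε
  have hε0 : 0 < ε := by
    have := Real.one_lt_rpow hr (by positivity : 0 < 1 / α); linarith
  have hεr : (1 + ε) ^ α = r := by
    rw [hε, add_sub_cancel, ← Real.rpow_mul (by linarith), one_div_mul_cancel hα.ne',
      Real.rpow_one]
  let f : ℝ → ℝ := fun x => max 0 (min 1 ((x - 2) / (2 * ε)))
  have hf0 (x : ℝ) : 0 ≤ f x := le_max_left _ _
  have hf1 (x : ℝ) : f x ≤ 1 := max_le zero_le_one (min_le_left _ _)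
  have hf2 (x : ℝ) (hx : x ≤ 2) : f x = 0 := by
    have : (x - 2) / (2 * ε) ≤ 0 := div_nonpos_of_nonpos_of_nonneg (by linarith) (by linarith)
    exact max_eq_left ((min_le_right _ _).trans this)
  have hf3 (x : ℝ) (hx : 2 * (1 + ε) ≤ x) : f x = 1 := by
    have : 1 ≤ (x - 2) / (2 * ε) := by rw [le_div_iff₀ (by positivity)]; linarith
    simp [f, min_eq_left this]
  have hfc : Continuous f := by fun_prop
  obtain ⟨N, hN⟩ := h.exists_tendsto_integral hfc
    (fun x => by rw [abs_of_nonneg (hf0 x)]; exact hf1 x) hf2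
  have hint (l : ℝ) : Integrable (fun x => f (l⁻¹ * x)) μ := by
    refine (integrable_const (1 : ℝ)).mono' (by fun_prop) (ae_of_all _ fun x => ?_)
    rw [Real.norm_of_nonneg (hf0 _)]; exact hf1 _
  have hind (a : ℝ) : Integrable ((Set.Ioi a).indicator (fun _ : ℝ => (1 : ℝ))) μ :=
    (integrable_const _).indicator measurableSet_Ioi
  have hup {l : ℝ} (hl : 0 < l) : ∫ x, f (l⁻¹ * x) ∂μ ≤ μ.real (Set.Ioi (2 * l)) := by
    rw [← integral_indicator_one measurableSet_Ioi]
    refine integral_mono (hint l) (hind _) fun x => ?_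
    rcases le_or_gt x (2 * l) with hx | hx
    · beta_reduce
      rw [hf2 _ (by rw [inv_mul_le_iff₀ hl]; linarith)]
      exact Set.indicator_nonneg (fun _ _ => zero_le_one) _
    · rw [Set.indicator_of_mem (show x ∈ Set.Ioi (2 * l) from hx)]
      exact hf1 _
  have hlo {l : ℝ} (hl : 0 < l) :
      μ.real (Set.Ioi (2 * (1 + ε) * l)) ≤ ∫ x, f (l⁻¹ * x) ∂μ := by
    rw [← integral_indicator_one measurableSet_Ioi]
    refine integral_mono (hind _) (hint l) fun x => ?_
    rcases le_or_gt x (2 * (1 + ε) * l) with hx | hx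
    · rw [Set.indicator_of_notMem (show x ∉ Set.Ioi (2 * (1 + ε) * l) from not_lt.2 hx)]
      exact hf0 _
    · beta_reduce
      rw [hf3 _ (by rw [le_inv_mul_iff₀ hl]; linarith)]
      exact Set.indicator_le_self' (fun _ _ => zero_le_one) _
  -- The ramp starts at level `x = 2 * l`, so `x ^ α = 2 ^ α * l ^ α`.
  refine ⟨2 ^ α * N, fun η hη => ?_⟩
  have hN2 := hN.const_mul ((2 : ℝ) ^ α)
  have hA : Tendsto (fun x : ℝ => x / 2) atTop atTop := tendsto_id.atTop_div_const (by norm_num)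
  have hB : Tendsto (fun x : ℝ => x / (2 * (1 + ε))) atTop atTop :=
    tendsto_id.atTop_div_const (by positivity)
  filter_upwards [eventually_gt_atTop 0,
    (hN2.comp hA).eventually (lt_mem_nhds (show 2 ^ α * N - η < 2 ^ α * N by linarith)),
    ((hN2.const_mul r).comp hB).eventually
      (gt_mem_nhds (show r * (2 ^ α * N) < r * (2 ^ α * N) + η by linarith))] with x hx h1 h2
  simp only [Function.comp] at h1 h2
  constructor
  · refine h1.le.trans ?_
    have := hup (l := x / 2) (by positivity)
    rw [mul_div_cancel₀ x (two_ne_zero), ← mul_assoc,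
      ← Real.mul_rpow (by norm_num) (by positivity), mul_div_cancel₀ x (two_ne_zero)] at *
    gcongr
  · refine le_trans ?_ h2.le
    have hne : 2 * (1 + ε) ≠ 0 := by positivity
    have := hlo (l := x / (2 * (1 + ε))) (by positivity)
    rw [mul_div_cancel₀ x hne] at this
    rw [← mul_assoc, ← mul_assoc, ← hεr, ← Real.mul_rpow (by positivity) (by norm_num),
      ← Real.mul_rpow (by positivity) (by positivity), mul_comm (1 + ε) 2,
      mul_div_cancel₀ x hne]
    gcongr

theorem neg [IsProbabilityMeasure μ] (h : HasHomogeneousExponent μ α c ψ) :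
    HasHomogeneousExponent (μ.map (fun x => -1 * x)) α c (fun t => ψ (-t)) where
  charFun_eq t := by rw [charFun_map_mul, neg_one_mul, h.charFun_eq]
  cont := h.cont.comp continuous_neg
  hom t l hl := by rw [← mul_neg, h.hom _ _ hl]
  re_eq t := by rw [h.re_eq, abs_neg]
  c_pos := h.c_pos
  index_pos := h.index_pos

/-- This is the real part of `tendsto_rescaled`; `not_tendsto_zero` compares its values at `t = 1`
and `t = 2`. -/
theorem tendsto_integral_one_sub_cos [IsProbabilityMeasure μ]
    (h : HasHomogeneousExponent μ α c ψ) {t : ℝ} (ht : 0 ≤ t) :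
    Tendsto (fun l : ℝ => l ^ α * ∫ x, (1 - Real.cos (t * (l⁻¹ * x))) ∂μ) atTop
      (𝓝 (c * t ^ α)) := by
  have h1 := ((Complex.continuous_re.tendsto _).comp (h.tendsto_rescaled t)).neg
  rw [h.re_eq, neg_neg, abs_of_nonneg ht] at h1
  refine h1.congr fun l => ?_
  have hi := integrable_exp_mul_I μ (l⁻¹ * t)
  have hre := integral_re hi
  simp only [Function.comp, Complex.re_ofReal_mul, Complex.sub_re, Complex.one_re,
    charFun_apply_real]
  have e1 : (∫ x : ℝ, Complex.exp ((l⁻¹ * t : ℝ) * x * Complex.I) ∂μ).re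
      = ∫ x, Real.cos (t * (l⁻¹ * x)) ∂μ := by
    rw [← RCLike.re_eq_complex_re, ← hre]
    congr 1 with x
    rw [RCLike.re_eq_complex_re, ← Complex.ofReal_mul, Complex.exp_ofReal_mul_I_re]
    congr 1; ring
  have hc : Integrable (fun x => Real.cos (t * (l⁻¹ * x))) μ :=
    (integrable_const (1 : ℝ)).mono' (by fun_prop) (ae_of_all _ fun x => Real.abs_cos_le_one _)
  rw [e1, integral_sub (integrable_const _) hc]
  simp
  ring

/-- The combination `4 (1 - cos y) - (1 - cos 2y) = 2 (1 - cos y) ^ 2` has rescaled limit `c (4 - 2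
^ α)`, positive because `α < 2`. It is at most `δ ^ 2 (1 - cos y)` for `|y| ≤ δ` and at most `8`
elsewhere. If both tail constants vanished, the limit would be at most `δ ^ 2 c`, which is half of
it by the choice of `δ`. -/
theorem not_tendsto_zero [IsProbabilityMeasure μ] (h : HasHomogeneousExponent μ α c ψ)
    (hα : α < 2) {a b : ℝ}
    (h1 : Tendsto (fun x : ℝ => x ^ α * μ.real (Set.Ioi x)) atTop (𝓝 a))
    (h2 : Tendsto (fun x : ℝ => x ^ α * μ.real (Set.Iio (-x))) atTop (𝓝 b)) :
    a + b ≠ 0 := by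
  intro hab
  have hα0 := h.index_pos
  have hc := h.c_pos
  have hpow : (2 : ℝ) ^ α < 4 := by
    have := Real.rpow_lt_rpow_of_exponent_lt (x := 2) (by norm_num) hα
    norm_num at this; exact this
  set δ : ℝ := Real.sqrt ((4 - 2 ^ α) / 2) with hδ
  have hδ0 : 0 < δ := Real.sqrt_pos.2 (by linarith)
  have hδ2 : δ ^ 2 = (4 - 2 ^ α) / 2 := Real.sq_sqrt (by linarith)
  have hpt (y : ℝ) : 4 * (1 - Real.cos y) - (1 - Real.cos (2 * y))
      ≤ δ ^ 2 * (1 - Real.cos y) + 8 * (Set.Ioi δ ∪ Set.Iio (-δ)).indicator (fun _ => (1 : ℝ)) y := by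
    have e : 4 * (1 - Real.cos y) - (1 - Real.cos (2 * y)) = 2 * (1 - Real.cos y) ^ 2 := by
      rw [Real.cos_two_mul]; ring
    have hc1 := Real.cos_le_one y
    have hc2 := Real.neg_one_le_cos y
    rw [e]
    by_cases hy : y ∈ Set.Ioi δ ∪ Set.Iio (-δ)
    · rw [Set.indicator_of_mem hy]
      nlinarith [sq_nonneg δ]
    · rw [Set.indicator_of_notMem hy]
      simp only [Set.mem_union, Set.mem_Ioi, Set.mem_Iio, not_or, not_lt] at hy
      have h3 := Real.one_sub_sq_div_two_le_cos (x := y)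
      have h4 : y ^ 2 ≤ δ ^ 2 := sq_le_sq' hy.2 hy.1
      nlinarith
  have hcos (t l : ℝ) : Integrable (fun x => 1 - Real.cos (t * (l⁻¹ * x))) μ :=
    (integrable_const _).sub
      ((integrable_const (1 : ℝ)).mono' (by fun_prop) (ae_of_all _ fun x => Real.abs_cos_le_one _))
  have hmain : ∀ᶠ l : ℝ in atTop,
      4 * (l ^ α * ∫ x, (1 - Real.cos (1 * (l⁻¹ * x))) ∂μ)
        - l ^ α * ∫ x, (1 - Real.cos (2 * (l⁻¹ * x))) ∂μ
      ≤ δ ^ 2 * (l ^ α * ∫ x, (1 - Real.cos (1 * (l⁻¹ * x))) ∂μ)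
        + 8 * (δ ^ α)⁻¹ * ((δ * l) ^ α * μ.real (Set.Ioi (δ * l))
          + (δ * l) ^ α * μ.real (Set.Iio (-(δ * l)))) := by
    filter_upwards [eventually_gt_atTop 0] with l hl
    have hind : Integrable ((Set.Ioi (δ * l) ∪ Set.Iio (-(δ * l))).indicator
        (fun _ : ℝ => (1 : ℝ))) μ :=
      (integrable_const _).indicator (measurableSet_Ioi.union measurableSet_Iio)
    have := integral_mono (((hcos 1 l).const_mul 4).sub (hcos 2 l))
      (((hcos 1 l).const_mul (δ ^ 2)).add (hind.const_mul 8)) (fun x => by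
        have := hpt (l⁻¹ * x)
        have hmem : (Set.Ioi δ ∪ Set.Iio (-δ)).indicator (fun _ => (1 : ℝ)) (l⁻¹ * x)
            = (Set.Ioi (δ * l) ∪ Set.Iio (-(δ * l))).indicator (fun _ => (1 : ℝ)) x := by
          have : l⁻¹ * x ∈ Set.Ioi δ ∪ Set.Iio (-δ)
              ↔ x ∈ Set.Ioi (δ * l) ∪ Set.Iio (-(δ * l)) := by
            simp only [Set.mem_union, Set.mem_Ioi, Set.mem_Iio]
            rw [lt_inv_mul_iff₀ hl, inv_mul_lt_iff₀ hl, mul_comm l, mul_comm l, neg_mul]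
          simp only [Set.indicator_apply, this]
        rw [hmem] at this
        simpa using this)
    simp only [Pi.sub_apply, Pi.add_apply] at this
    rw [integral_sub ((hcos 1 l).const_mul 4) (hcos 2 l),
      integral_add ((hcos 1 l).const_mul (δ ^ 2)) (hind.const_mul 8), integral_const_mul,
      integral_const_mul, integral_const_mul] at this
    have e : ∫ x, (Set.Ioi (δ * l) ∪ Set.Iio (-(δ * l))).indicator (fun _ => (1 : ℝ)) x ∂μ
        ≤ μ.real (Set.Ioi (δ * l)) + μ.real (Set.Iio (-(δ * l))) :=
      (integral_indicator_one (measurableSet_Ioi.union measurableSet_Iio)).trans_le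
        (measureReal_union_le _ _)
    have hl' : 0 < l ^ α := by positivity
    have hd' : 0 < δ ^ α := by positivity
    have e2 : 8 * (δ ^ α)⁻¹ * ((δ * l) ^ α * μ.real (Set.Ioi (δ * l))
          + (δ * l) ^ α * μ.real (Set.Iio (-(δ * l))))
        = l ^ α * (8 * (μ.real (Set.Ioi (δ * l)) + μ.real (Set.Iio (-(δ * l))))) := by
      rw [Real.mul_rpow hδ0.le hl.le]; field_simp
    rw [e2]
    have := mul_le_mul_of_nonneg_left (this.trans (add_le_add_right
      (mul_le_mul_of_nonneg_left e (by norm_num : (0 : ℝ) ≤ 8)) _)) hl'.le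
    linarith
  have hL := (h.tendsto_integral_one_sub_cos zero_le_one)
  have hL2 := (h.tendsto_integral_one_sub_cos zero_le_two)
  have hδl : Tendsto (fun l : ℝ => δ * l) atTop atTop := tendsto_id.const_mul_atTop hδ0
  have := le_of_tendsto_of_tendsto ((hL.const_mul 4).sub hL2)
    ((hL.const_mul (δ ^ 2)).add (((h1.comp hδl).add (h2.comp hδl)).const_mul (8 * (δ ^ α)⁻¹)))
    hmain
  rw [hab, Real.one_rpow, hδ2] at this
  nlinarith

end HasHomogeneousExponent

/-- Since `x / (x + m) → 1`, centring the law does not affect its tail constants. -/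
theorem tendsto_shift_tail {α k : ℝ} {T : ℝ → ℝ} (m : ℝ)
    (h : Tendsto (fun x : ℝ => x ^ α * T x) atTop (𝓝 k)) :
    Tendsto (fun x : ℝ => x ^ α * T (x + m)) atTop (𝓝 k) := by
  have h1 : Tendsto (fun x : ℝ => (x + m) ^ α * T (x + m)) atTop (𝓝 k) :=
    h.comp (tendsto_atTop_add_const_right _ m tendsto_id)
  have h2 : Tendsto (fun x : ℝ => (x / (x + m)) ^ α) atTop (𝓝 1) := by
    have : Tendsto (fun x : ℝ => x / (x + m)) atTop (𝓝 1) := by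
      have h3 : Tendsto (fun x : ℝ => 1 - m / (x + m)) atTop (𝓝 (1 - 0)) :=
        tendsto_const_nhds.sub
          ((tendsto_atTop_add_const_right _ m tendsto_id).const_div_atTop m)
      rw [sub_zero] at h3
      refine h3.congr' ?_
      filter_upwards [eventually_gt_atTop (-m)] with x hx
      have : x + m ≠ 0 := by linarith
      field_simp; ring
    simpa using this.rpow_const (p := α) (Or.inl one_ne_zero)
  refine (by simpa using h2.mul h1 : Tendsto _ atTop (𝓝 k)).congr' ?_
  filter_upwards [eventually_gt_atTop (-m), eventually_gt_atTop 0] with x hx hx0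
  have : 0 < x + m := by linarith
  rw [← mul_assoc, ← Real.mul_rpow (by positivity) this.le, div_mul_cancel₀ _ this.ne']

/-- Translation by `-m` removes the drift. The exponent on the negative half-line is the conjugate,
which flips the sign of the `p.im` term. -/
theorem IsStableLaw.exists_hasHomogeneousExponent {α : ℝ} (hα : 1 < α) {ν : Measure ℝ}
    (hν : IsStableLaw α ν) :
    ∃ (m c : ℝ) (ψ : ℝ → ℂ), HasHomogeneousExponent (ν.map (fun x => x + m)) α c ψ := by
  have := hν.isProbabilityMeasure
  have hα0 : 0 < α := by linarith
  obtain ⟨p, m, hp, h⟩ := hν.exists_charFun_eq hα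
  refine ⟨-m, -p.re, fun t => (p.re * |t| ^ α : ℝ)
    + (p.im * (max t 0 ^ α - max (-t) 0 ^ α) : ℝ) * Complex.I, ?_, ?_, ?_, ?_, by linarith, hα0⟩
  · have hpos (t : ℝ) (ht : 0 ≤ t) : charFun (ν.map (fun x => x + -m)) t
        = Complex.exp ((p.re * t ^ α : ℝ) + (p.im * t ^ α : ℝ) * Complex.I) := by
      rw [charFun_map_add_const, h t ht, ← Complex.exp_add]
      congr 1
      have := Complex.re_add_im p
      simp
      linear_combination -(t ^ α : ℝ) * this
    intro t
    rcases le_total 0 t with ht | ht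
    · rw [hpos t ht, abs_of_nonneg ht, max_eq_left ht, max_eq_right (by linarith),
        Real.zero_rpow hα0.ne', sub_zero]
    · rw [← neg_neg t, charFun_neg, hpos (-t) (by linarith), neg_neg, abs_of_nonpos ht,
        max_eq_right ht, max_eq_left (by linarith), Real.zero_rpow hα0.ne', ← Complex.exp_conj]
      simp
  · have (f : ℝ → ℝ) (hf : Continuous f) : Continuous fun t => f t ^ α :=
      hf.rpow_const fun _ => Or.inr hα0.le
    have h1 := this (fun t => |t|) (by fun_prop)
    have h2 := this (fun t => max t 0) (by fun_prop)
    have h3 := this (fun t => max (-t) 0) (by fun_prop)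
    fun_prop
  · intro t l hl
    have e1 (x : ℝ) : max (l⁻¹ * x) 0 = l⁻¹ * max x 0 := by
      rw [mul_max_of_nonneg _ _ (by positivity), mul_zero]
    have hl' : ((l ^ α : ℝ) : ℂ) ≠ 0 := by exact_mod_cast (by positivity : 0 < l ^ α).ne'
    rw [← mul_neg, e1, e1, abs_mul, abs_of_pos (by positivity : 0 < l⁻¹),
      Real.mul_rpow (by positivity) (by positivity), Real.mul_rpow (by positivity) (by positivity),
      Real.mul_rpow (by positivity) (by positivity), Real.inv_rpow hl.le]
    push_cast
    field_simp
  · intro t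
    simp

/-- Tails of stable laws. -/
theorem IsStableLaw.exists_tendsto_tails {α : ℝ} (hα : 1 < α) (hα2 : α < 2) {ν : Measure ℝ}
    (hν : IsStableLaw α ν) :
    ∃ a b : ℝ, 0 ≤ a ∧ 0 ≤ b ∧ 0 < a + b ∧
      Tendsto (fun x : ℝ => x ^ α * ν.real (Set.Ioi x)) atTop (𝓝 a) ∧
      Tendsto (fun x : ℝ => x ^ α * ν.real (Set.Iio (-x))) atTop (𝓝 b) := by
  have := hν.isProbabilityMeasure
  obtain ⟨m, c, ψ, h⟩ := hν.exists_hasHomogeneousExponent hα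
  set μ := ν.map (fun x => x + m) with hμ
  have : IsProbabilityMeasure μ := Measure.isProbabilityMeasure_map (by fun_prop)
  obtain ⟨a, ha, hta⟩ := h.exists_tendsto_tail
  have : IsProbabilityMeasure (μ.map (fun x : ℝ => -1 * x)) :=
    Measure.isProbabilityMeasure_map (by fun_prop)
  obtain ⟨b, hb, htb⟩ := h.neg.exists_tendsto_tail
  have e (x : ℝ) : (μ.map (fun x => -1 * x)).real (Set.Ioi x) = μ.real (Set.Iio (-x)) := by
    rw [map_measureReal_apply (by fun_prop) measurableSet_Ioi]
    congr 1; ext y; simp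
  simp only [e] at htb
  have hab := h.not_tendsto_zero hα2 hta htb
  refine ⟨a, b, ha, hb, (add_nonneg ha hb).lt_of_ne hab.symm, ?_, ?_⟩
  · refine (tendsto_shift_tail m hta).congr fun x => ?_
    rw [hμ, map_measureReal_apply (by fun_prop) measurableSet_Ioi]
    congr 2; ext y; simp
  · refine (tendsto_shift_tail (T := fun x => μ.real (Set.Iio (-x))) (-m) htb).congr fun x => ?_
    rw [hμ, map_measureReal_apply (by fun_prop) measurableSet_Iio]
    congr 2; ext y; simp

/-! ### Laplace transforms and the Abelian theorem -/

theorem measurable_measureReal_Ioi (τ : Measure ℝ) [IsFiniteMeasure τ] :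
    Measurable fun u => τ.real (Set.Ioi u) :=
  Antitone.measurable fun _ _ h => measureReal_mono (Set.Ioi_subset_Ioi h)

/-- The Laplace transform of a law on `[0, ∞)` in terms of its tail. -/
theorem one_sub_laplace_eq (τ : Measure ℝ) [IsProbabilityMeasure τ] (hτ : ∀ᵐ x ∂τ, 0 ≤ x)
    {s : ℝ} (hs : 0 < s) :
    1 - ∫ x, Real.exp (-(s * x)) ∂τ
      = ∫ u in Set.Ioi (0 : ℝ), s * Real.exp (-(s * u)) * τ.real (Set.Ioi u) := by
  have hle : ∀ᵐ x ∂τ, Real.exp (-(s * x)) ≤ 1 := by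
    filter_upwards [hτ] with x hx
    exact Real.exp_le_one_iff.2 (by simp; positivity)
  have hi : Integrable (fun x => Real.exp (-(s * x))) τ :=
    (integrable_const (1 : ℝ)).mono' (by fun_prop) (by
      filter_upwards [hle] with x hx
      rwa [Real.norm_of_nonneg (Real.exp_nonneg _)])
  have h1 : 1 - ∫ x, Real.exp (-(s * x)) ∂τ = ∫ x, (1 - Real.exp (-(s * x))) ∂τ := by
    rw [integral_sub (integrable_const _) hi]; simp
  have hprim (x : ℝ) : ∫ u in (0 : ℝ)..x, s * Real.exp (-(s * u)) = 1 - Real.exp (-(s * x)) := by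
    have := intervalIntegral.integral_eq_sub_of_hasDerivAt (a := 0) (b := x)
      (f := fun u => -Real.exp (-(s * u))) (f' := fun u => s * Real.exp (-(s * u)))
      (fun u _ => by
        have : HasDerivAt (fun u => -Real.exp (-(s * u))) (-(Real.exp (-(s * u)) * -(s * 1))) u :=
          (((hasDerivAt_id u).const_mul s).neg.exp).neg
        exact this.congr_deriv (by ring))
      ((by fun_prop : Continuous _).intervalIntegrable _ _)
    rw [this]; simp; ring
  -- Layer-cake formula for `1 - exp (-(s * x))`, the primitive of `s * exp (-(s * u))`.
  have key := lintegral_comp_eq_lintegral_meas_lt_mul (f := fun x : ℝ => x)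
    (g := fun u => s * Real.exp (-(s * u))) τ hτ (by fun_prop)
    (fun t _ => (by fun_prop : Continuous _).intervalIntegrable _ _)
    (ae_of_all _ fun t => by positivity)
  simp only [hprim] at key
  rw [h1, integral_eq_lintegral_of_nonneg_ae (by filter_upwards [hle] with x hx; simpa using hx)
    (by fun_prop), key, integral_eq_lintegral_of_nonneg_ae (ae_of_all _ fun u => by positivity)
    (by have := measurable_measureReal_Ioi τ; fun_prop)]
  congr 1
  refine lintegral_congr fun u => ?_
  rw [ENNReal.ofReal_mul (p := s * Real.exp (-(s * u))) (by positivity), ofReal_measureReal,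
    mul_comm]
  rfl

/-- The substitution `u = x * v` at `s = t / x` exposes the rescaled tail, whose limit is a multiple
of `v ^ (-κ)` under regular variation. -/
theorem one_sub_laplace_scaled (τ : Measure ℝ) [IsProbabilityMeasure τ] (hτ : ∀ᵐ x ∂τ, 0 ≤ x)
    {t x : ℝ} (ht : 0 < t) (hx : 0 < x) (κ : ℝ) :
    x ^ κ * (1 - ∫ y, Real.exp (-(t / x * y)) ∂τ)
      = t * ∫ v in Set.Ioi (0 : ℝ), Real.exp (-(t * v)) * (x ^ κ * τ.real (Set.Ioi (x * v))) := by
  rw [one_sub_laplace_eq τ hτ (div_pos ht hx)]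
  have := integral_comp_mul_left_Ioi
    (fun u => t / x * Real.exp (-(t / x * u)) * τ.real (Set.Ioi u)) 0 hx
  rw [mul_zero, smul_eq_mul, eq_inv_mul_iff_mul_eq₀ hx.ne'] at this
  rw [← this, ← integral_const_mul, ← integral_const_mul, ← integral_const_mul]
  congr 1 with v
  have e : t / x * (x * v) = t * v := by field_simp
  rw [e]; field_simp

theorem exists_tail_le {κ c : ℝ} (hκ : 0 < κ) {τ : Measure ℝ} [IsProbabilityMeasure τ]
    (h : Tendsto (fun x : ℝ => x ^ κ * τ.real (Set.Ioi x)) atTop (𝓝 c)) :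
    ∃ C : ℝ, ∀ x : ℝ, 0 < x → x ^ κ * τ.real (Set.Ioi x) ≤ C := by
  obtain ⟨x₀, hx₀⟩ := eventually_atTop.1 (h.eventually (gt_mem_nhds (lt_add_one c)))
  refine ⟨max (c + 1) (|x₀| ^ κ), fun x hx => ?_⟩
  rcases le_total x₀ x with hle | hle
  · exact (hx₀ x hle).le.trans (le_max_left _ _)
  · refine le_trans ?_ (le_max_right _ _)
    calc x ^ κ * τ.real (Set.Ioi x) ≤ |x₀| ^ κ * 1 := by
          gcongr
          · exact hle.trans (le_abs_self _)
          · exact measureReal_le_one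
      _ = _ := mul_one _

theorem integrableOn_exp_mul_rpow_neg {κ : ℝ} (hκ : κ < 1) :
    IntegrableOn (fun v : ℝ => Real.exp (-v) * v ^ (-κ)) (Set.Ioi 0) := by
  have := Real.GammaIntegral_convergent (s := 1 - κ) (by linarith)
  simpa [sub_sub_cancel_left] using this

theorem rescaled_tail_eq {κ x v : ℝ} (hx : 0 < x) (hv : 0 < v) (T : ℝ → ℝ) :
    x ^ κ * T (x * v) = v ^ (-κ) * ((x * v) ^ κ * T (x * v)) := by
  have : v ^ κ ≠ 0 := by positivity
  rw [Real.mul_rpow hx.le hv.le, Real.rpow_neg hv.le]; field_simp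

theorem integral_exp_mul_rpow_neg {κ : ℝ} (hκ : κ < 1) :
    ∫ v in Set.Ioi (0 : ℝ), Real.exp (-v) * v ^ (-κ) = Real.Gamma (1 - κ) := by
  rw [Real.Gamma_eq_integral (by linarith), sub_sub_cancel_left]

/-- Abelian theorem for Laplace transforms, with a uniform bound. -/
theorem laplace_of_tail {κ c : ℝ} (hκ : 0 < κ) (hκ1 : κ < 1) {τ : Measure ℝ}
    [IsProbabilityMeasure τ] (hτ : ∀ᵐ x ∂τ, 0 ≤ x)
    (h : Tendsto (fun x : ℝ => x ^ κ * τ.real (Set.Ioi x)) atTop (𝓝 c)) :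
    Tendsto (fun x : ℝ => x ^ κ * (1 - ∫ y, Real.exp (-(1 / x * y)) ∂τ)) atTop
      (𝓝 (c * Real.Gamma (1 - κ))) ∧
    ∃ C : ℝ, 0 ≤ C ∧ ∀ s : ℝ, 0 ≤ s → 1 - ∫ y, Real.exp (-(s * y)) ∂τ ≤ C * s ^ κ := by
  obtain ⟨C, hC⟩ := exists_tail_le hκ h
  have hC0 : 0 ≤ C := le_trans (by positivity) (hC 1 one_pos)
  -- The rescaled tail is at most `C * v ^ (-κ)`, integrable against `exp (-v)` because `κ < 1`. The
  -- same majorant serves both the limit and the uniform bound.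
  have hbound {x v : ℝ} (hx : 0 < x) (hv : 0 < v) :
      Real.exp (-(1 * v)) * (x ^ κ * τ.real (Set.Ioi (x * v)))
        ≤ C * (Real.exp (-v) * v ^ (-κ)) := by
    rw [rescaled_tail_eq hx hv fun u => τ.real (Set.Ioi u), one_mul]
    have := hC (x * v) (by positivity)
    calc _ ≤ Real.exp (-v) * (v ^ (-κ) * C) := by gcongr
      _ = _ := by ring
  have hmeas (x : ℝ) : Measurable fun v => τ.real (Set.Ioi (x * v)) :=
    (measurable_measureReal_Ioi τ).comp (measurable_const_mul x)
  have hint : IntegrableOn (fun v : ℝ => C * (Real.exp (-v) * v ^ (-κ))) (Set.Ioi 0) :=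
    (integrableOn_exp_mul_rpow_neg hκ1).const_mul C
  constructor
  · have hlim : Tendsto (fun x : ℝ => ∫ v in Set.Ioi (0 : ℝ),
        Real.exp (-(1 * v)) * (x ^ κ * τ.real (Set.Ioi (x * v)))) atTop
        (𝓝 (∫ v in Set.Ioi (0 : ℝ), c * (Real.exp (-v) * v ^ (-κ)))) := by
      refine tendsto_integral_filter_of_dominated_convergence _
        (Eventually.of_forall fun x => (by have := hmeas x; fun_prop : Measurable _).aestronglyMeasurable) ?_ hint ?_
      · filter_upwards [eventually_gt_atTop 0] with x hx
        refine ae_restrict_of_forall_mem measurableSet_Ioi fun v hv => ?_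
        rw [Real.norm_of_nonneg (by positivity)]
        exact hbound hx hv
      · refine ae_restrict_of_forall_mem measurableSet_Ioi fun v hv => ?_
        have hv : 0 < v := hv
        have h1 := (h.comp (tendsto_id.atTop_mul_const hv)).const_mul (v ^ (-κ))
        have h2 := h1.const_mul (Real.exp (-(1 * v)))
        rw [one_mul, show Real.exp (-v) * (v ^ (-κ) * c) = c * (Real.exp (-v) * v ^ (-κ)) by
          ring] at h2
        refine h2.congr' ?_
        filter_upwards [eventually_gt_atTop 0] with x hx
        rw [rescaled_tail_eq hx hv fun u => τ.real (Set.Ioi u), one_mul]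
        rfl
    rw [integral_const_mul, integral_exp_mul_rpow_neg hκ1] at hlim
    refine hlim.congr' ?_
    filter_upwards [eventually_gt_atTop 0] with x hx
    rw [one_sub_laplace_scaled τ hτ one_pos hx, one_mul]
  · have hΓ : 0 < Real.Gamma (1 - κ) := Real.Gamma_pos_of_pos (by linarith)
    refine ⟨C * Real.Gamma (1 - κ), by positivity, fun s hs => ?_⟩
    rcases hs.eq_or_lt with rfl | hs
    · simp [Real.zero_rpow hκ.ne']
    have e := one_sub_laplace_scaled τ hτ one_pos (inv_pos.2 hs) κ
    rw [one_div, inv_inv, Real.inv_rpow hs.le, inv_mul_eq_iff_eq_mul₀ (by positivity), one_mul] at e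
    rw [e, mul_comm]
    gcongr
    rw [← integral_exp_mul_rpow_neg hκ1, ← integral_const_mul]
    refine integral_mono_of_nonneg (ae_of_all _ fun v => by positivity) hint ?_
    refine ae_restrict_of_forall_mem measurableSet_Ioi fun v hv => ?_
    have := hbound (inv_pos.2 hs) hv
    rwa [Real.inv_rpow hs.le] at this

/-! ### Karamata's Tauberian theorem -/

/-- Integral against `exp (-v) G(v) dv` of a function of `exp (-v)`. -/
noncomputable def expIntegral (G h : ℝ → ℝ) : ℝ :=
  ∫ v in Set.Ioi (0 : ℝ), h (Real.exp (-v)) * (Real.exp (-v) * G v)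

theorem integrable_expIntegral {G h : ℝ → ℝ} (hh : Continuous h)
    (hG : IntegrableOn (fun v => Real.exp (-v) * G v) (Set.Ioi 0)) :
    IntegrableOn (fun v => h (Real.exp (-v)) * (Real.exp (-v) * G v)) (Set.Ioi 0) := by
  obtain ⟨C, hC⟩ := (isCompact_Icc (a := (0 : ℝ)) (b := 1)).exists_bound_of_continuousOn
    hh.continuousOn
  refine Integrable.bdd_mul (c := C) hG (by fun_prop) ?_
  refine ae_restrict_of_forall_mem measurableSet_Ioi fun v hv => hC _ ⟨Real.exp_nonneg _, ?_⟩
  exact Real.exp_le_one_iff.2 (by have : 0 < v := hv; linarith)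

theorem abs_expIntegral_sub_le {G g h : ℝ → ℝ} {ε : ℝ} (hg : Continuous g) (hh : Continuous h)
    (hG : IntegrableOn (fun v => Real.exp (-v) * G v) (Set.Ioi 0))
    (hG0 : ∀ v, 0 < v → 0 ≤ G v) (hε : ∀ y ∈ Set.Icc (0 : ℝ) 1, |g y - h y| ≤ ε) :
    |expIntegral G g - expIntegral G h| ≤ ε * expIntegral G (fun _ => 1) := by
  rw [expIntegral, expIntegral, expIntegral, ← integral_sub (integrable_expIntegral hg hG)
    (integrable_expIntegral hh hG), ← integral_const_mul]
  simp only [one_mul]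
  refine (abs_integral_le_integral_abs).trans ?_
  refine setIntegral_mono_on ?_ (hG.const_mul ε) measurableSet_Ioi fun v hv => ?_
  · exact ((integrable_expIntegral hg hG).sub (integrable_expIntegral hh hG)).abs
  · rw [← sub_mul, abs_mul, abs_of_nonneg (mul_nonneg (Real.exp_nonneg _) (hG0 v hv))]
    have := hG0 v hv
    gcongr
    exact hε _ ⟨Real.exp_nonneg _, Real.exp_le_one_iff.2 (by have : 0 < v := hv; linarith)⟩

/-- Convergence of Laplace transforms at the positive integers implies convergence of the integrals
of all continuous functions of `exp (-v)`. -/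
theorem tendsto_expIntegral {G : ℝ → ℝ → ℝ} {G₀ : ℝ → ℝ}
    (hG : ∀ᶠ x in atTop, IntegrableOn (fun v => Real.exp (-v) * G x v) (Set.Ioi 0))
    (hGn : ∀ᶠ x in atTop, ∀ v, 0 < v → 0 ≤ G x v)
    (hG₀ : IntegrableOn (fun v => Real.exp (-v) * G₀ v) (Set.Ioi 0))
    (hGn₀ : ∀ v, 0 < v → 0 ≤ G₀ v)
    (hk : ∀ k : ℕ, Tendsto (fun x => expIntegral (G x) (fun y => y ^ k)) atTop
      (𝓝 (expIntegral G₀ (fun y => y ^ k))))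
    {h : ℝ → ℝ} (hh : Continuous h) :
    Tendsto (fun x => expIntegral (G x) h) atTop (𝓝 (expIntegral G₀ h)) := by
  have hpoly (p : Polynomial ℝ) : Tendsto (fun x => expIntegral (G x) (fun y => p.eval y)) atTop
      (𝓝 (expIntegral G₀ (fun y => p.eval y))) := by
    have add (p q : Polynomial ℝ) {H : ℝ → ℝ}
        (hH : IntegrableOn (fun v => Real.exp (-v) * H v) (Set.Ioi 0)) :
        expIntegral H (fun y => (p + q).eval y)
          = expIntegral H (fun y => p.eval y) + expIntegral H (fun y => q.eval y) := by
      rw [expIntegral, expIntegral, expIntegral,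
        ← integral_add (integrable_expIntegral p.continuous hH)
          (integrable_expIntegral q.continuous hH)]
      simp only [Polynomial.eval_add, add_mul]
    have mon (a : ℝ) (k : ℕ) (H : ℝ → ℝ) :
        expIntegral H (fun y => (Polynomial.monomial k a).eval y)
          = a * expIntegral H (fun y => y ^ k) := by
      rw [expIntegral, expIntegral, ← integral_const_mul]
      simp only [Polynomial.eval_monomial, mul_assoc]
    induction p using Polynomial.induction_on' with
    | add p q hp hq =>
      rw [add p q hG₀]
      refine (hp.add hq).congr' ?_
      filter_upwards [hG] with x hx
      rw [add p q hx]
    | monomial k a =>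
      simp only [mon]
      exact (hk k).const_mul a
  set A : ℝ := expIntegral G₀ (fun _ => 1) with hA
  have hA1 : Tendsto (fun x => expIntegral (G x) (fun _ => 1)) atTop (𝓝 A) := by
    simpa using hk 0
  have hA0 : 0 ≤ A := setIntegral_nonneg measurableSet_Ioi fun v hv => by
    have := hGn₀ v hv; positivity
  rw [Metric.tendsto_nhds]
  intro ε hε
  -- Two polynomial approximations cost at most `η * (A + 1)` and `η * A`, and the polynomial limit
  -- costs `η`; the total is below `ε`.
  set η : ℝ := ε / (2 * (A + 1) + 1) with hη
  have hη0 : 0 < η := by positivity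
  have hηε : η * (2 * (A + 1) + 1) = ε := div_mul_cancel₀ _ (by positivity)
  obtain ⟨p, hp⟩ := exists_polynomial_near_of_continuousOn 0 1 h hh.continuousOn η hη0
  filter_upwards [hG, hGn, hA1.eventually (gt_mem_nhds (lt_add_one A)),
    (Metric.tendsto_nhds.1 (hpoly p)) η hη0] with x h1 h2 h3 h4
  have e1 := abs_expIntegral_sub_le p.continuous hh h1 h2 (fun y hy => (hp y hy).le)
  have e2 := abs_expIntegral_sub_le p.continuous hh hG₀ hGn₀ (fun y hy => (hp y hy).le)
  rw [Real.dist_eq] at h4 ⊢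
  have e3 : η * expIntegral (G x) (fun _ => 1) ≤ η * (A + 1) := by gcongr
  rw [abs_le] at e1 e2
  rw [abs_lt] at h4 ⊢
  rw [← hA] at e2
  constructor <;> nlinarith

/-- Karamata's Tauberian theorem for Laplace transforms of laws on `[0, ∞)`, index in `(0, 1)`. -/
theorem tail_of_laplace {κ M : ℝ} (hκ : 0 < κ) (hκ1 : κ < 1) (hM : 0 ≤ M) {τ : Measure ℝ}
    [IsProbabilityMeasure τ] (hτ : ∀ᵐ x ∂τ, 0 ≤ x)
    (h : Tendsto (fun x : ℝ => x ^ κ * (1 - ∫ y, Real.exp (-(1 / x * y)) ∂τ)) atTop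
      (𝓝 (M * Real.Gamma (1 - κ)))) :
    Tendsto (fun x : ℝ => x ^ κ * τ.real (Set.Ioi x)) atTop (𝓝 M) := by
  set G : ℝ → ℝ → ℝ := fun x v => x ^ κ * τ.real (Set.Ioi (x * v)) with hGdef
  set G₀ : ℝ → ℝ := fun v => M * v ^ (-κ) with hG₀def
  have hmeas (x : ℝ) : Measurable fun v => τ.real (Set.Ioi (x * v)) :=
    (measurable_measureReal_Ioi τ).comp (measurable_const_mul x)
  have hGi : ∀ᶠ x in atTop, IntegrableOn (fun v => Real.exp (-v) * G x v) (Set.Ioi 0) := by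
    filter_upwards [eventually_gt_atTop 0] with x hx
    have h1 : IntegrableOn (fun v : ℝ => Real.exp (-v) * x ^ κ) (Set.Ioi 0) := by
      have := (exp_neg_integrableOn_Ioi 0 one_pos).mul_const (x ^ κ)
      simpa [IntegrableOn] using this
    refine Integrable.mono' h1
      (Measurable.aestronglyMeasurable (by have := hmeas x; simp only [hGdef]; fun_prop)) (ae_of_all _ fun v => ?_)
    rw [Real.norm_of_nonneg (by positivity)]
    have : τ.real (Set.Ioi (x * v)) ≤ 1 := measureReal_le_one
    have h0 : 0 ≤ x ^ κ := by positivity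
    gcongr
    exact mul_le_of_le_one_right h0 this
  have hGn : ∀ᶠ x in atTop, ∀ v, 0 < v → 0 ≤ G x v := by
    filter_upwards [eventually_gt_atTop 0] with x hx v hv
    positivity
  have hGi₀ : IntegrableOn (fun v => Real.exp (-v) * G₀ v) (Set.Ioi 0) := by
    refine ((integrableOn_exp_mul_rpow_neg hκ1).const_mul M).congr (ae_of_all _ fun v => ?_)
    simp only [hG₀def]; ring
  have hGn₀ : ∀ v, 0 < v → 0 ≤ G₀ v := fun v hv => by positivity
  have hexp (k : ℕ) (v : ℝ) :
      Real.exp (-v) ^ k * Real.exp (-v) = Real.exp (-(((k : ℝ) + 1) * v)) := by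
    rw [← Real.exp_nat_mul, ← Real.exp_add]; congr 1; ring
  -- The `k`-th power of `exp (-v)` yields the Laplace transform at `(k + 1) / x`, that is, the
  -- hypothesis at `x / (k + 1)`.
  have hk (k : ℕ) : Tendsto (fun x => expIntegral (G x) (fun y => y ^ k)) atTop
      (𝓝 (expIntegral G₀ (fun y => y ^ k))) := by
    have hk0 : (0 : ℝ) < (k : ℝ) + 1 := by positivity
    have e0 : expIntegral G₀ (fun y => y ^ k)
        = ((k : ℝ) + 1)⁻¹ * (((k : ℝ) + 1) ^ κ * (M * Real.Gamma (1 - κ))) := by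
      have := Real.integral_rpow_mul_exp_neg_mul_Ioi (a := 1 - κ) (by linarith) hk0
      rw [expIntegral]
      simp only [← mul_assoc, hexp, hG₀def]
      have e (v : ℝ) : Real.exp (-(((k : ℝ) + 1) * v)) * M * v ^ (-κ)
          = M * (v ^ (1 - κ - 1) * Real.exp (-(((k : ℝ) + 1) * v))) := by
        rw [show 1 - κ - 1 = -κ by ring]; ring
      simp only [e]
      rw [integral_const_mul, this, one_div, Real.inv_rpow hk0.le, Real.rpow_sub hk0,
        Real.rpow_one]
      field_simp
    rw [e0]
    have h1 := (h.comp (tendsto_id.atTop_div_const hk0)).const_mul (((k : ℝ) + 1) ^ κ)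
    refine (h1.const_mul (((k : ℝ) + 1)⁻¹)).congr' ?_
    filter_upwards [eventually_gt_atTop 0] with x hx
    simp only [Function.comp, id]
    rw [one_div_div, ← mul_assoc (((k : ℝ) + 1) ^ κ), ← Real.mul_rpow hk0.le (by positivity),
      mul_div_cancel₀ _ hk0.ne', one_sub_laplace_scaled τ hτ hk0 hx, inv_mul_cancel_left₀ hk0.ne',
      expIntegral]
    simp only [← mul_assoc, hexp, hGdef]
  have hlim {g : ℝ → ℝ} (hg : Continuous g) := tendsto_expIntegral hGi hGn hGi₀ hGn₀ hk hg
  -- a bump function supported on `[a, b]`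
  have hbump (a b : ℝ) (ha : 0 < a) (hab : a < b) : ∃ L : ℝ, M * b ^ (-κ) ≤ L ∧ L ≤ M * a ^ (-κ) ∧
      ∀ η > 0, ∀ᶠ x in atTop, G x b ≤ L + η ∧ L - η ≤ G x a := by
    set g : ℝ → ℝ := fun y => max 0 ((y - Real.exp (-b)) * (Real.exp (-a) - y)) with hg
    have hgc : Continuous g := by fun_prop
    have hg0 (y : ℝ) : 0 ≤ g y := le_max_left _ _
    have hgsupp (v : ℝ) (hv : v ∉ Set.Ioo a b) : g (Real.exp (-v)) = 0 := by
      refine max_eq_left ?_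
      rw [Set.mem_Ioo, not_and_or, not_lt, not_lt] at hv
      rcases hv with hv | hv
      · have h1 : Real.exp (-a) ≤ Real.exp (-v) := Real.exp_le_exp.2 (by linarith)
        have h2 : Real.exp (-b) ≤ Real.exp (-v) := Real.exp_le_exp.2 (by linarith)
        exact mul_nonpos_of_nonneg_of_nonpos (by linarith) (by linarith)
      · have h1 : Real.exp (-v) ≤ Real.exp (-b) := Real.exp_le_exp.2 (by linarith)
        have h2 : Real.exp (-v) ≤ Real.exp (-a) := Real.exp_le_exp.2 (by linarith)
        exact mul_nonpos_of_nonpos_of_nonneg (by linarith) (by linarith)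
    have h1i : IntegrableOn (fun v : ℝ => Real.exp (-v) * (fun _ : ℝ => (1 : ℝ)) v) (Set.Ioi 0) := by
      simpa using exp_neg_integrableOn_Ioi 0 one_pos
    set B : ℝ := expIntegral (fun _ => 1) g with hB
    have hBpos : 0 < B := by
      rw [hB, expIntegral, setIntegral_pos_iff_support_of_nonneg_ae
        (ae_of_all _ fun v => by have := hg0 (Real.exp (-v)); simp only [Pi.zero_apply]; positivity)
        (integrable_expIntegral hgc h1i)]
      refine lt_of_lt_of_le ?_ (measure_mono (s := Set.Ioo a b) fun v hv => ?_)
      · simpa using hab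
      · refine ⟨?_, ha.trans hv.1⟩
        have h1 : Real.exp (-v) < Real.exp (-a) := Real.exp_lt_exp.2 (by linarith [hv.1])
        have h2 : Real.exp (-b) < Real.exp (-v) := Real.exp_lt_exp.2 (by linarith [hv.2])
        have : 0 < g (Real.exp (-v)) :=
          lt_max_of_lt_right (mul_pos (by linarith) (by linarith))
        rw [Function.mem_support]
        positivity
    have hupper {H : ℝ → ℝ} {D : ℝ} (hH : IntegrableOn (fun v => Real.exp (-v) * H v) (Set.Ioi 0))
        (hD : ∀ v ∈ Set.Ioo a b, H v ≤ D) : expIntegral H g ≤ D * B := by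
      rw [hB, expIntegral, expIntegral, ← integral_const_mul]
      refine integral_mono (integrable_expIntegral hgc hH)
        ((integrable_expIntegral hgc h1i).const_mul D) fun v => ?_
      by_cases hv : v ∈ Set.Ioo a b
      · have := hD v hv
        have := hg0 (Real.exp (-v))
        calc _ ≤ g (Real.exp (-v)) * (Real.exp (-v) * D) := by gcongr
          _ = _ := by ring
      · simp [hgsupp v hv]
    have hlower {H : ℝ → ℝ} {D : ℝ} (hH : IntegrableOn (fun v => Real.exp (-v) * H v) (Set.Ioi 0))
        (hD : ∀ v ∈ Set.Ioo a b, D ≤ H v) : D * B ≤ expIntegral H g := by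
      rw [hB, expIntegral, expIntegral, ← integral_const_mul]
      refine integral_mono ((integrable_expIntegral hgc h1i).const_mul D)
        (integrable_expIntegral hgc hH) fun v => ?_
      by_cases hv : v ∈ Set.Ioo a b
      · have := hD v hv
        have := hg0 (Real.exp (-v))
        calc _ = g (Real.exp (-v)) * (Real.exp (-v) * D) := by ring
          _ ≤ _ := by gcongr
      · simp [hgsupp v hv]
    -- `L` is a weighted mean of `G₀` over `(a, b)`. Monotonicity of `G x` compares the
    -- corresponding mean of `G x` with its endpoint values.
    refine ⟨expIntegral G₀ g / B, ?_, ?_, fun η hη => ?_⟩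
    · rw [le_div_iff₀ hBpos]
      refine hlower hGi₀ fun v hv => ?_
      exact mul_le_mul_of_nonneg_left (Real.rpow_le_rpow_of_nonpos (ha.trans hv.1) hv.2.le
        (by linarith)) hM
    · rw [div_le_iff₀ hBpos]
      refine hupper hGi₀ fun v hv => ?_
      exact mul_le_mul_of_nonneg_left (Real.rpow_le_rpow_of_nonpos ha hv.1.le (by linarith)) hM
    · have hl := (hlim hgc).div_const B
      filter_upwards [hGi, eventually_gt_atTop 0, hl.eventually
        (gt_mem_nhds (lt_add_of_pos_right _ hη)), hl.eventually
        (lt_mem_nhds (sub_lt_self _ hη))] with x h1 h2 h3 h4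
      have anti {u v : ℝ} (huv : u ≤ v) : G x v ≤ G x u := by
        have : τ.real (Set.Ioi (x * v)) ≤ τ.real (Set.Ioi (x * u)) :=
          measureReal_mono (Set.Ioi_subset_Ioi (by gcongr))
        exact mul_le_mul_of_nonneg_left this (by positivity)
      constructor
      · refine le_trans ?_ h3.le
        rw [le_div_iff₀ hBpos]
        exact hlower h1 fun v hv => anti hv.2.le
      · refine h4.le.trans ?_
        rw [div_le_iff₀ hBpos]
        exact hupper h1 fun v hv => anti hv.1.le
  have hG1 (x : ℝ) : G x 1 = x ^ κ * τ.real (Set.Ioi x) := by simp [hGdef]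
  simp only [← hG1]
  have hcont : Tendsto (fun r : ℝ => M * r ^ (-κ)) (𝓝 1) (𝓝 M) := by
    have := ((Real.continuousAt_rpow_const 1 (-κ) (Or.inl one_ne_zero)).tendsto).const_mul M
    simpa using this
  -- A bump just to the right of `1` bounds `G x 1` from below, one just to the left bounds it from
  -- above, and `M * r ^ (-κ) → M` as `r → 1`.
  rw [tendsto_order]
  constructor
  · intro u hu
    obtain ⟨r, hr, hr1⟩ := ((hcont.mono_left nhdsWithin_le_nhds).eventually (lt_mem_nhds hu)
      |>.and (self_mem_nhdsWithin (s := Set.Ioi (1 : ℝ)))).exists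
    obtain ⟨L, hL1, hL2, hL⟩ := hbump 1 r one_pos hr1
    filter_upwards [hL ((L - u) / 2) (by linarith)] with x hx
    linarith [hx.2]
  · intro u hu
    obtain ⟨r, hr, hr1⟩ := ((hcont.mono_left nhdsWithin_le_nhds).eventually (gt_mem_nhds hu)
      |>.and (Ioo_mem_nhdsLT (show (1 / 2 : ℝ) < 1 by norm_num))).exists
    obtain ⟨L, hL1, hL2, hL⟩ := hbump r 1 (by linarith [hr1.1]) hr1.2
    filter_upwards [hL ((u - L) / 2) (by linarith)] with x hx
    linarith [hx.1]

/-! ### Randomly weighted sums -/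

/-- A crude Bonferroni inequality. It linearises the product of conditional Laplace transforms with
a quadratic error. -/
theorem one_sub_prod_one_sub_bounds {ι : Type*} (F : Finset ι) {a : ι → ℝ}
    (h0 : ∀ i, 0 ≤ a i) (h1 : ∀ i, a i ≤ 1) :
    ∑ i ∈ F, a i - (∑ i ∈ F, a i) ^ 2 ≤ 1 - ∏ i ∈ F, (1 - a i) ∧
      1 - ∏ i ∈ F, (1 - a i) ≤ ∑ i ∈ F, a i := by
  classical
  induction F using Finset.induction_on with
  | empty => simp
  | insert j F hj ih =>
    rw [Finset.sum_insert hj, Finset.prod_insert hj]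
    have hp : ∏ i ∈ F, (1 - a i) ≤ 1 :=
      Finset.prod_le_one (fun i _ => by linarith [h1 i]) (fun i _ => by linarith [h0 i])
    have hS : 0 ≤ ∑ i ∈ F, a i := Finset.sum_nonneg fun i _ => h0 i
    have hj0 := h0 j
    set p := ∏ i ∈ F, (1 - a i)
    set S := ∑ i ∈ F, a i
    have h3 : a j * (1 - S) ≤ a j * p := by gcongr; linarith [ih.2]
    have h4 : a j * p ≤ a j * 1 := by gcongr
    constructor
    · nlinarith [ih.1, mul_nonneg hj0 hS, sq_nonneg (a j)]
    · nlinarith [ih.2]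

theorem measurable_laplace (τ : Measure ℝ) [SFinite τ] :
    Measurable fun s : ℝ => ∫ x, Real.exp (-(s * x)) ∂τ :=
  (StronglyMeasurable.integral_prod_right (f := fun s x : ℝ => Real.exp (-(s * x)))
    (Continuous.stronglyMeasurable (by fun_prop))).measurable

theorem integrable_exp_neg_of_nonneg {Ω : Type*} [MeasurableSpace Ω] {P : Measure Ω}
    [IsFiniteMeasure P] {X : Ω → ℝ} (hX : AEMeasurable X P) (h : ∀ᵐ ω ∂P, 0 ≤ X ω) :
    Integrable (fun ω => Real.exp (-X ω)) P := by
  refine (integrable_const (1 : ℝ)).mono' (by fun_prop) ?_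
  filter_upwards [h] with ω hω
  rw [Real.norm_of_nonneg (Real.exp_nonneg _)]
  exact Real.exp_le_one_iff.2 (by linarith)

theorem laplace_mem_Icc {τ : Measure ℝ} [IsProbabilityMeasure τ] (hτ : ∀ᵐ x ∂τ, 0 ≤ x) {s : ℝ}
    (hs : 0 ≤ s) : ∫ x, Real.exp (-(s * x)) ∂τ ∈ Set.Icc (0 : ℝ) 1 := by
  have hn : ∀ᵐ x ∂τ, 0 ≤ s * x := by
    filter_upwards [hτ] with x hx; positivity
  refine ⟨integral_nonneg fun x => Real.exp_nonneg _, ?_⟩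
  have := integral_mono_ae (integrable_exp_neg_of_nonneg (by fun_prop) hn)
    (integrable_const (1 : ℝ)) (by
      filter_upwards [hn] with x hx
      exact Real.exp_le_one_iff.2 (by linarith))
  simpa using this

/-- If `∑ E[1 - exp (-Y_n)] < ∞` with `Y_n ≥ 0`, then `∑ Y_n` converges almost surely. -/
theorem ae_summable_of_summable_laplace {Ω : Type*} [MeasurableSpace Ω] {P : Measure Ω}
    [IsFiniteMeasure P] {Y : ℕ → Ω → ℝ} (hY : ∀ n, Measurable (Y n)) (h0 : ∀ n ω, 0 ≤ Y n ω)
    (h : Summable fun n => ∫ ω, (1 - Real.exp (-Y n ω)) ∂P) :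
    ∀ᵐ ω ∂P, Summable fun n => Y n ω := by
  have hg0 (n : ℕ) (ω : Ω) : 0 ≤ 1 - Real.exp (-Y n ω) := by
    have := Real.exp_le_one_iff.2 (neg_nonpos.2 (h0 n ω)); linarith
  have hfin : ∫⁻ ω, ∑' n, ENNReal.ofReal (1 - Real.exp (-Y n ω)) ∂P ≠ ⊤ := by
    rw [lintegral_tsum fun n => by have := hY n; fun_prop]
    have e (n : ℕ) : ∫⁻ ω, ENNReal.ofReal (1 - Real.exp (-Y n ω)) ∂P
        = ENNReal.ofReal (∫ ω, (1 - Real.exp (-Y n ω)) ∂P) :=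
      (ofReal_integral_eq_lintegral_ofReal ((integrable_const _).sub
        (integrable_exp_neg_of_nonneg (hY n).aemeasurable (ae_of_all _ (h0 n))))
        (ae_of_all _ (hg0 n))).symm
    simp only [e]
    exact h.tsum_ofReal_ne_top
  have hae := ae_lt_top' (Measurable.aemeasurable (by fun_prop)) hfin
  filter_upwards [hae] with ω hω
  have hs : Summable fun n => 1 - Real.exp (-Y n ω) := by
    have := ENNReal.summable_toReal hω.ne
    simpa [ENNReal.toReal_ofReal (hg0 _ ω)] using this
  -- Once `1 - exp (-Y) < 1 / 2`, the inequality `exp (-Y) * (Y + 1) ≤ 1` gives `Y ≤ 2 * (1 - exp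
  -- (-Y))`.
  have hev := hs.tendsto_atTop_zero.eventually (gt_mem_nhds (show (0 : ℝ) < 1 / 2 by norm_num))
  refine Summable.of_norm_bounded_eventually_nat (hs.mul_left 2) ?_
  filter_upwards [hev] with n hn
  rw [Real.norm_of_nonneg (h0 n ω)]
  have h1 := Real.add_one_le_exp (Y n ω)
  have h2 : Real.exp (-Y n ω) * Real.exp (Y n ω) = 1 := by rw [← Real.exp_add]; simp
  have h3 := h0 n ω
  have h4 : Real.exp (-Y n ω) * (Y n ω + 1) ≤ 1 := by
    exact (mul_le_mul_of_nonneg_left h1 (Real.exp_nonneg _)).trans h2.le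
  nlinarith

theorem measurable_tsum_of_nonneg {Ω : Type*} [MeasurableSpace Ω] {Y : ℕ → Ω → ℝ}
    (hY : ∀ n, Measurable (Y n)) (h0 : ∀ n ω, 0 ≤ Y n ω) :
    Measurable fun ω => ∑' n, Y n ω := by
  have : (fun ω => ∑' n, Y n ω) = fun ω => (∑' n, ENNReal.ofReal (Y n ω)).toReal := by
    ext ω
    rw [ENNReal.tsum_toReal_eq fun n => ENNReal.ofReal_ne_top]
    simp [ENNReal.toReal_ofReal (h0 _ ω)]
  rw [this]
  fun_prop

section Mixture

variable {Ω : Type*} [MeasurableSpace Ω] {P : Measure Ω} [IsProbabilityMeasure P]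
  {W T : ℕ → Ω → ℝ} {τ : Measure ℝ}

/-- Conditionally on the weights, the Laplace transform of a weighted sum is a product. -/
theorem laplace_weighted_sum (hW : ∀ n, Measurable (W n)) (hT : ∀ n, Measurable (T n))
    (hW0 : ∀ n ω, 0 ≤ W n ω) (hT0 : ∀ n ω, 0 ≤ T n ω) (hlaw : ∀ n, P.map (T n) = τ)
    (hind : iIndepFun T P) (hWT : IndepFun (fun ω n => W n ω) (fun ω n => T n ω) P)
    (F : Finset ℕ) {s : ℝ} (hs : 0 ≤ s) :
    ∫ ω, Real.exp (-(s * ∑ n ∈ F, W n ω * T n ω)) ∂P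
      = ∫ ω, ∏ n ∈ F, (∫ x, Real.exp (-(s * W n ω * x)) ∂τ) ∂P := by
  have hWm : Measurable fun ω n => W n ω := measurable_pi_lambda _ hW
  have hTm : Measurable fun ω n => T n ω := measurable_pi_lambda _ hT
  let Φ : (ℕ → ℝ) × (ℕ → ℝ) → ℝ := fun z => Real.exp (-(s * ∑ n ∈ F, z.1 n * z.2 n))
  have hΦ : Measurable Φ := by fun_prop
  have hprod := hWT.map_prod_eq_prod_map_map hWm.aemeasurable hTm.aemeasurable
  -- With the weights frozen at `w`, independence of the `T n` factors the exponential.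
  have hinner (w : ℕ → ℝ) : ∫ t, Φ (w, t) ∂(P.map fun ω n => T n ω)
      = ∏ n ∈ F, ∫ x, Real.exp (-(s * w n * x)) ∂τ := by
    have hΦw : Measurable fun t => Φ (w, t) := hΦ.comp measurable_prodMk_left
    rw [integral_map hTm.aemeasurable hΦw.aestronglyMeasurable]
    have hc := (hind.precomp (g := fun i : F => (i : ℕ)) Subtype.val_injective).comp
      (fun (i : F) x => Real.exp (-(s * w i * x))) (fun i => by fun_prop)
    have e := hc.integral_fun_prod_eq_prod_integral
      (fun i => (((by fun_prop : Measurable fun x => Real.exp (-(s * w i * x)))).comp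
        (hT i)).aestronglyMeasurable)
    rw [← Finset.prod_coe_sort F (fun n => ∫ x, Real.exp (-(s * w n * x)) ∂τ)]
    have e2 (i : F) : ∫ x, Real.exp (-(s * w i * x)) ∂τ
        = ∫ ω, ((fun x => Real.exp (-(s * w i * x))) ∘ T i) ω ∂P := by
      rw [← hlaw i, integral_map (hT i).aemeasurable (by fun_prop)]
      rfl
    simp only [e2]
    rw [← e]
    congr 1 with ω
    simp only [Φ, Function.comp]
    rw [Finset.prod_coe_sort F (fun n => Real.exp (-(s * w n * T n ω))), ← Real.exp_sum,
      Finset.mul_sum, ← Finset.sum_neg_distrib]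
    congr 1
    exact Finset.sum_congr rfl fun n _ => by ring
  have hΦi : Integrable Φ (P.map fun ω => (fun n => W n ω, fun n => T n ω)) := by
    rw [integrable_map_measure hΦ.aestronglyMeasurable (hWm.prodMk hTm).aemeasurable]
    refine integrable_exp_neg_of_nonneg
      (X := fun ω => s * ∑ n ∈ F, W n ω * T n ω) (by fun_prop) (ae_of_all _ fun ω => ?_)
    exact mul_nonneg hs (Finset.sum_nonneg fun n _ => mul_nonneg (hW0 n ω) (hT0 n ω))
  have e1 : ∫ ω, Real.exp (-(s * ∑ n ∈ F, W n ω * T n ω)) ∂P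
      = ∫ z, Φ z ∂(P.map fun ω => (fun n => W n ω, fun n => T n ω)) := by
    rw [integral_map (hWm.prodMk hTm).aemeasurable hΦ.aestronglyMeasurable]
  have : IsProbabilityMeasure (P.map fun ω n => T n ω) :=
    Measure.isProbabilityMeasure_map hTm.aemeasurable
  rw [hprod] at hΦi e1
  rw [e1, integral_prod _ hΦi]
  simp only [hinner]
  have hm : Measurable fun w : ℕ → ℝ => ∏ n ∈ F, ∫ x, Real.exp (-(s * w n * x)) ∂τ := by
    have : IsProbabilityMeasure τ := by
      rw [← hlaw 0]; exact Measure.isProbabilityMeasure_map (hT 0).aemeasurable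
    refine Finset.measurable_prod _ fun n _ => ?_
    have h1 : Measurable fun w : ℕ → ℝ => s * w n := by fun_prop
    exact (measurable_laplace τ).comp h1
  rw [integral_map hWm.aemeasurable hm.aestronglyMeasurable]

/-- Convergence and tail of a randomly weighted sum of independent regularly varying nonnegative
variables of index `κ < 1`. -/
theorem weighted_sum_tail {κ c K : ℝ} (hκ : 0 < κ) (hκ1 : κ < 1) (hc : 0 ≤ c)
    (hW : ∀ n, Measurable (W n)) (hT : ∀ n, Measurable (T n))
    (hW0 : ∀ n ω, 0 ≤ W n ω) (hW1 : ∀ᵐ ω ∂P, ∀ n, W n ω ≤ 1) (hT0 : ∀ n ω, 0 ≤ T n ω)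
    (hlaw : ∀ n, P.map (T n) = τ)
    (hind : iIndepFun T P) (hWT : IndepFun (fun ω n => W n ω) (fun ω n => T n ω) P)
    (htail : Tendsto (fun x : ℝ => x ^ κ * τ.real (Set.Ioi x)) atTop (𝓝 c))
    (hWi : ∀ n, Integrable (fun ω => W n ω ^ κ) P)
    (hK : HasSum (fun n => ∫ ω, W n ω ^ κ ∂P) K) :
    (∀ᵐ ω ∂P, Summable fun n => W n ω * T n ω) ∧
    Tendsto (fun x : ℝ => x ^ κ * P.real {ω | x < ∑' n, W n ω * T n ω}) atTop (𝓝 (c * K)) := by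
  have hτp : IsProbabilityMeasure τ := by
    rw [← hlaw 0]; exact Measure.isProbabilityMeasure_map (hT 0).aemeasurable
  have hτ : ∀ᵐ x ∂τ, 0 ≤ x := by
    rw [← hlaw 0, ae_map_iff (hT 0).aemeasurable measurableSet_Ici]
    exact ae_of_all _ (hT0 0)
  set f : ℝ → ℝ := fun s => ∫ x, Real.exp (-(s * x)) ∂τ with hf
  have hfm : Measurable f := measurable_laplace τ
  obtain ⟨hlim, C, hC0, hC⟩ := laplace_of_tail hκ hκ1 hτ htail
  have hf01 {s : ℝ} (hs : 0 ≤ s) : f s ∈ Set.Icc (0 : ℝ) 1 := laplace_mem_Icc hτ hs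
  set w : ℕ → ℝ := fun n => ∫ ω, W n ω ^ κ ∂P with hw
  have hw0 (n : ℕ) : 0 ≤ w n := integral_nonneg fun ω => by have := hW0 n ω; positivity
  have hK0 : 0 ≤ K := hK.nonneg hw0
  set β : ℕ → ℝ → ℝ := fun n s => ∫ ω, (1 - f (s * W n ω)) ∂P with hβ
  have hlap (F : Finset ℕ) {s : ℝ} (hs : 0 ≤ s) :
      ∫ ω, Real.exp (-(s * ∑ n ∈ F, W n ω * T n ω)) ∂P = ∫ ω, ∏ n ∈ F, f (s * W n ω) ∂P :=
    laplace_weighted_sum hW hT hW0 hT0 hlaw hind hWT F hs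
  have hWs {s : ℝ} (hs : 0 ≤ s) (n : ℕ) (ω : Ω) : 0 ≤ s * W n ω := mul_nonneg hs (hW0 n ω)
  have hfle {s : ℝ} (hs : 0 ≤ s) (n : ℕ) (ω : Ω) :
      1 - f (s * W n ω) ≤ C * s ^ κ * W n ω ^ κ := by
    have := hC _ (hWs hs n ω)
    rwa [Real.mul_rpow hs (hW0 n ω), ← mul_assoc] at this
  have hfi {s : ℝ} (hs : 0 ≤ s) (n : ℕ) : Integrable (fun ω => 1 - f (s * W n ω)) P := by
    refine (integrable_const (1 : ℝ)).mono' (Measurable.aestronglyMeasurable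
      (measurable_const.sub (hfm.comp ((hW n).const_mul s)))) (ae_of_all _ fun ω => ?_)
    have := hf01 (hWs hs n ω)
    rw [Real.norm_of_nonneg (by linarith [this.2])]
    linarith [this.1]
  have hβle {s : ℝ} (hs : 0 ≤ s) (n : ℕ) : β n s ≤ C * s ^ κ * w n := by
    rw [hβ, hw, ← integral_const_mul]
    exact integral_mono (hfi hs n) ((hWi n).const_mul _) fun ω => hfle hs n ω
  have hβ0 {s : ℝ} (hs : 0 ≤ s) (n : ℕ) : 0 ≤ β n s :=
    integral_nonneg fun ω => by have := (hf01 (hWs hs n ω)).2; simp only [Pi.zero_apply]; linarith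
  have hY0 (n : ℕ) (ω : Ω) : 0 ≤ W n ω * T n ω := mul_nonneg (hW0 n ω) (hT0 n ω)
  have hYm (n : ℕ) : Measurable fun ω => W n ω * T n ω := (hW n).mul (hT n)
  have hsum : ∀ᵐ ω ∂P, Summable fun n => W n ω * T n ω := by
    refine ae_summable_of_summable_laplace hYm hY0 ?_
    have e (n : ℕ) : ∫ ω, (1 - Real.exp (-(W n ω * T n ω))) ∂P = β n 1 := by
      have h1 := hlap {n} zero_le_one
      simp only [Finset.sum_singleton, Finset.prod_singleton, one_mul] at h1
      have hfi' : Integrable (fun ω => f (W n ω)) P := by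
        refine ((integrable_const (1 : ℝ)).sub (hfi zero_le_one n)).congr (ae_of_all _ fun ω => ?_)
        simp
      simp only [hβ, one_mul]
      rw [integral_sub (integrable_const _) hfi', integral_sub (integrable_const _)
        (integrable_exp_neg_of_nonneg (hYm n).aemeasurable (ae_of_all _ (hY0 n))), h1]
    simp only [e]
    refine Summable.of_nonneg_of_le (hβ0 zero_le_one) (hβle zero_le_one) ?_
    exact hK.summable.mul_left _
  refine ⟨hsum, ?_⟩
  set Q : Ω → ℝ := fun ω => ∑' n, W n ω * T n ω with hQ
  have hQm : Measurable Q := measurable_tsum_of_nonneg hYm hY0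
  have hQ0 (ω : Ω) : 0 ≤ Q ω := tsum_nonneg fun n => hY0 n ω
  have hpart0 (N : ℕ) (ω : Ω) : 0 ≤ ∑ n ∈ Finset.range N, W n ω * T n ω :=
    Finset.sum_nonneg fun n _ => hY0 n ω
  have hpartm (N : ℕ) : Measurable fun ω => ∑ n ∈ Finset.range N, W n ω * T n ω :=
    Finset.measurable_sum _ fun n _ => hYm n
  have hpi (N : ℕ) {s : ℝ} (hs : 0 ≤ s) :
      Integrable (fun ω => ∏ n ∈ Finset.range N, f (s * W n ω)) P := by
    refine (integrable_const (1 : ℝ)).mono' (Measurable.aestronglyMeasurable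
      (Finset.measurable_prod _ fun n _ => hfm.comp ((hW n).const_mul s)))
      (ae_of_all _ fun ω => ?_)
    rw [Real.norm_of_nonneg (Finset.prod_nonneg fun n _ => (hf01 (hWs hs n ω)).1)]
    exact Finset.prod_le_one (fun n _ => (hf01 (hWs hs n ω)).1)
      (fun n _ => (hf01 (hWs hs n ω)).2)
  have hbounds (N : ℕ) {s : ℝ} (hs : 0 ≤ s) (ω : Ω) := one_sub_prod_one_sub_bounds
    (Finset.range N) (a := fun n => 1 - f (s * W n ω))
    (fun n => by linarith [(hf01 (hWs hs n ω)).2]) (fun n => by linarith [(hf01 (hWs hs n ω)).1])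
  simp only [sub_sub_cancel] at hbounds
  have hone (N : ℕ) {s : ℝ} (hs : 0 ≤ s) :
      1 - ∫ ω, Real.exp (-(s * ∑ n ∈ Finset.range N, W n ω * T n ω)) ∂P
        = ∫ ω, (1 - ∏ n ∈ Finset.range N, f (s * W n ω)) ∂P := by
    rw [hlap _ hs, integral_sub (integrable_const _) (hpi N hs)]; simp
  have hfsum (N : ℕ) {s : ℝ} (hs : 0 ≤ s) :
      Integrable (fun ω => ∑ n ∈ Finset.range N, (1 - f (s * W n ω))) P :=
    integrable_finsetSum _ fun n _ => hfi hs n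
  have hupperN (N : ℕ) {s : ℝ} (hs : 0 ≤ s) :
      1 - ∫ ω, Real.exp (-(s * ∑ n ∈ Finset.range N, W n ω * T n ω)) ∂P
        ≤ ∑ n ∈ Finset.range N, β n s := by
    rw [hone N hs, hβ, ← integral_finsetSum _ fun n _ => hfi hs n]
    exact integral_mono ((integrable_const _).sub (hpi N hs)) (hfsum N hs)
      fun ω => (hbounds N hs ω).2
  -- As `W n ≤ 1` almost surely, the squared sum is at most `(N * (C * s ^ κ)) ^ 2`. For fixed `N`
  -- this is of order `s ^ (2 * κ)`, negligible against `s ^ κ`.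
  have hlowerN (N : ℕ) {s : ℝ} (hs : 0 ≤ s) :
      ∑ n ∈ Finset.range N, β n s - (N * (C * s ^ κ)) ^ 2
        ≤ 1 - ∫ ω, Real.exp (-(s * ∑ n ∈ Finset.range N, W n ω * T n ω)) ∂P := by
    rw [hone N hs, hβ, ← integral_finsetSum _ fun n _ => hfi hs n]
    have e : ∫ ω, (∑ n ∈ Finset.range N, (1 - f (s * W n ω))) ∂P - (N * (C * s ^ κ)) ^ 2
        = ∫ ω, (∑ n ∈ Finset.range N, (1 - f (s * W n ω)) - (N * (C * s ^ κ)) ^ 2) ∂P := by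
      rw [integral_sub (hfsum N hs) (integrable_const _)]; simp
    rw [e]
    refine integral_mono_ae ((hfsum N hs).sub (integrable_const _))
      ((integrable_const _).sub (hpi N hs)) ?_
    filter_upwards [hW1] with ω hω
    refine le_trans ?_ (hbounds N hs ω).1
    have h1 : ∑ n ∈ Finset.range N, (1 - f (s * W n ω)) ≤ N * (C * s ^ κ) := by
      calc _ ≤ ∑ n ∈ Finset.range N, C * s ^ κ := by
            refine Finset.sum_le_sum fun n _ => (hfle hs n ω).trans ?_
            exact mul_le_of_le_one_right (by positivity)
              (Real.rpow_le_one (hW0 n ω) (hω n) hκ.le)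
        _ = _ := by simp
    have h0 : 0 ≤ ∑ n ∈ Finset.range N, (1 - f (s * W n ω)) :=
      Finset.sum_nonneg fun n _ => by linarith [(hf01 (hWs hs n ω)).2]
    gcongr
  have hβsum {s : ℝ} (hs : 0 ≤ s) : Summable fun n => β n s :=
    Summable.of_nonneg_of_le (hβ0 hs) (hβle hs) (hK.summable.mul_left _)
  have hlower (N : ℕ) {s : ℝ} (hs : 0 ≤ s) :
      ∑ n ∈ Finset.range N, β n s - (N * (C * s ^ κ)) ^ 2
        ≤ 1 - ∫ ω, Real.exp (-(s * Q ω)) ∂P := by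
    refine (hlowerN N hs).trans (sub_le_sub_left (integral_mono_ae ?_ ?_ ?_) _)
    · exact integrable_exp_neg_of_nonneg (hQm.const_mul s).aemeasurable
        (ae_of_all _ fun ω => mul_nonneg hs (hQ0 ω))
    · exact integrable_exp_neg_of_nonneg ((hpartm N).const_mul s).aemeasurable
        (ae_of_all _ fun ω => mul_nonneg hs (hpart0 N ω))
    · filter_upwards [hsum] with ω hω
      refine Real.exp_le_exp.2 (neg_le_neg (mul_le_mul_of_nonneg_left ?_ hs))
      exact hω.sum_le_tsum _ fun n _ => hY0 n ω
  have hupper {s : ℝ} (hs : 0 ≤ s) :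
      1 - ∫ ω, Real.exp (-(s * Q ω)) ∂P ≤ ∑' n, β n s := by
    have hl : Tendsto (fun N : ℕ =>
        ∫ ω, Real.exp (-(s * ∑ n ∈ Finset.range N, W n ω * T n ω)) ∂P) atTop
        (𝓝 (∫ ω, Real.exp (-(s * Q ω)) ∂P)) := by
      refine tendsto_integral_of_dominated_convergence (fun _ => (1 : ℝ)) (fun N => ?_)
        (integrable_const _) (fun N => ae_of_all _ fun ω => ?_) ?_
      · have := hpartm N
        exact Measurable.aestronglyMeasurable (by fun_prop)
      · rw [Real.norm_of_nonneg (Real.exp_nonneg _)]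
        exact Real.exp_le_one_iff.2 (neg_nonpos.2 (mul_nonneg hs (hpart0 N ω)))
      · filter_upwards [hsum] with ω hω
        exact (Real.continuous_exp.tendsto _).comp
          ((hω.hasSum.tendsto_sum_nat.const_mul s).neg)
    exact le_of_tendsto' (tendsto_const_nhds.sub hl) fun N =>
      (hupperN N hs).trans ((hβsum hs).sum_le_tsum _ fun n _ => hβ0 hs n)
  set Γ : ℝ := Real.Gamma (1 - κ) with hΓ
  have hxβle {x : ℝ} (hx : 0 < x) (n : ℕ) : x ^ κ * β n (1 / x) ≤ C * w n := by
    have h1 := hβle (one_div_nonneg.2 hx.le) n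
    have h2 : x ^ κ * (1 / x) ^ κ = 1 := by
      rw [← Real.mul_rpow hx.le (by positivity), mul_one_div_cancel hx.ne', Real.one_rpow]
    calc x ^ κ * β n (1 / x) ≤ x ^ κ * (C * (1 / x) ^ κ * w n) := by gcongr
      _ = C * w n * (x ^ κ * (1 / x) ^ κ) := by ring
      _ = C * w n := by rw [h2, mul_one]
  have hβlim (n : ℕ) : Tendsto (fun x : ℝ => x ^ κ * β n (1 / x)) atTop (𝓝 (c * Γ * w n)) := by
    have : Tendsto (fun x : ℝ => ∫ ω, x ^ κ * (1 - f (1 / x * W n ω)) ∂P) atTop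
        (𝓝 (∫ ω, c * Γ * W n ω ^ κ ∂P)) := by
      refine tendsto_integral_filter_of_dominated_convergence (fun ω => C * W n ω ^ κ)
        (Eventually.of_forall fun x => ?_) ?_ ((hWi n).const_mul C) (ae_of_all _ fun ω => ?_)
      · exact Measurable.aestronglyMeasurable
          ((measurable_const.sub (hfm.comp ((hW n).const_mul _))).const_mul _)
      · filter_upwards [eventually_gt_atTop 0] with x hx
        refine ae_of_all _ fun ω => ?_
        have hx' : 0 ≤ 1 / x := by positivity
        have h0 := (hf01 (hWs hx' n ω)).2
        rw [Real.norm_of_nonneg (mul_nonneg (by positivity) (by linarith))]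
        have h1 := hfle hx' n ω
        have h2 : x ^ κ * (1 / x) ^ κ = 1 := by
          rw [← Real.mul_rpow hx.le hx', mul_one_div_cancel hx.ne', Real.one_rpow]
        calc _ ≤ x ^ κ * (C * (1 / x) ^ κ * W n ω ^ κ) := by gcongr
          _ = C * W n ω ^ κ * (x ^ κ * (1 / x) ^ κ) := by ring
          _ = C * W n ω ^ κ := by rw [h2, mul_one]
      · rcases (hW0 n ω).eq_or_lt with h0 | h0
        · simp [← h0, hf, Real.zero_rpow hκ.ne']
        · have h1 := (hlim.comp (tendsto_id.atTop_div_const h0)).const_mul (W n ω ^ κ)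
          rw [mul_comm (c * Γ)]
          refine h1.congr' ?_
          filter_upwards [eventually_gt_atTop 0] with x hx
          simp only [Function.comp, id]
          rw [← mul_assoc, ← Real.mul_rpow h0.le (by positivity), mul_div_cancel₀ _ h0.ne',
            one_div_div, div_mul_eq_mul_div, one_mul, hf]
    simpa only [hβ, hw, integral_const_mul] using this
  -- Summability of `C * w n`, uniform in `x`, allows the limit to pass through the infinite sum.
  have hUlim : Tendsto (fun x : ℝ => ∑' n, x ^ κ * β n (1 / x)) atTop
      (𝓝 (∑' n, c * Γ * w n)) := by
    refine tendsto_tsum_of_dominated_convergence (bound := fun n => C * w n)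
      (hK.summable.mul_left C) hβlim ?_
    filter_upwards [eventually_gt_atTop 0] with x hx n
    rw [Real.norm_of_nonneg (mul_nonneg (by positivity) (hβ0 (by positivity) n))]
    exact hxβle hx n
  rw [tsum_mul_left, hK.tsum_eq] at hUlim
  -- The upper bound uses the whole series. The lower bound fixes a finite `N` first, so that the
  -- quadratic error vanishes as `x → ∞`.
  have hmain : Tendsto (fun x : ℝ => x ^ κ * (1 - ∫ ω, Real.exp (-(1 / x * Q ω)) ∂P)) atTop
      (𝓝 (c * Γ * K)) := by
    rw [tendsto_order]
    constructor
    · intro u hu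
      have hN : Tendsto (fun N : ℕ => c * Γ * ∑ n ∈ Finset.range N, w n) atTop
          (𝓝 (c * Γ * K)) := hK.tendsto_sum_nat.const_mul _
      obtain ⟨N, hN⟩ := (hN.eventually (lt_mem_nhds hu)).exists
      have h1 : Tendsto (fun x : ℝ => ∑ n ∈ Finset.range N, x ^ κ * β n (1 / x)
          - (N * C) ^ 2 * x ^ (-κ)) atTop
          (𝓝 (∑ n ∈ Finset.range N, c * Γ * w n - (N * C) ^ 2 * 0)) :=
        (tendsto_finsetSum _ fun n _ => hβlim n).sub ((tendsto_rpow_neg_atTop hκ).const_mul _)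
      rw [mul_zero, sub_zero, ← Finset.mul_sum] at h1
      filter_upwards [h1.eventually (lt_mem_nhds hN), eventually_gt_atTop 0] with x hx hx0
      refine hx.trans_le ?_
      have h2 := mul_le_mul_of_nonneg_left (hlower N (one_div_nonneg.2 hx0.le))
        (by positivity : 0 ≤ x ^ κ)
      refine le_trans (le_of_eq ?_) h2
      have h3 : 0 < x ^ κ := by positivity
      rw [mul_sub, Finset.mul_sum, Real.rpow_neg hx0.le, one_div, Real.inv_rpow hx0.le]
      field_simp
    · intro u hu
      filter_upwards [hUlim.eventually (gt_mem_nhds hu), eventually_gt_atTop 0] with x hx hx0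
      refine lt_of_le_of_lt ?_ hx
      rw [tsum_mul_left]
      exact mul_le_mul_of_nonneg_left (hupper (one_div_nonneg.2 hx0.le)) (by positivity)
  have hqp : IsProbabilityMeasure (P.map Q) := Measure.isProbabilityMeasure_map hQm.aemeasurable
  have hq0 : ∀ᵐ x ∂(P.map Q), 0 ≤ x := by
    rw [ae_map_iff hQm.aemeasurable measurableSet_Ici]
    exact ae_of_all _ hQ0
  have := tail_of_laplace hκ hκ1 (mul_nonneg hc hK0) hq0 (by
    have e (x : ℝ) : ∫ y, Real.exp (-(1 / x * y)) ∂(P.map Q)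
        = ∫ ω, Real.exp (-(1 / x * Q ω)) ∂P :=
      integral_map hQm.aemeasurable (by fun_prop)
    simp only [e]
    rw [mul_right_comm]
    exact hmain)
  refine this.congr fun x => ?_
  rw [map_measureReal_apply hQm measurableSet_Ioi]
  rfl

end Mixture

/-! ### Moments of the stick-breaking lengths -/

theorem stickRemainder_eq_prod (v : ℕ → ℝ) (n : ℕ) :
    stickRemainder v n = ∏ k ∈ Finset.range n, (1 - v k) := by
  induction n with
  | zero => rfl
  | succ n ih => rw [Finset.prod_range_succ, ← ih, stickRemainder]; ring

theorem stickLength_mem_Icc {v : ℕ → ℝ} (hv : ∀ n, v n ∈ Set.Ioo (0 : ℝ) 1) (n : ℕ) :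
    stickLength v n ∈ Set.Icc (0 : ℝ) 1 := by
  have h0 : 0 ≤ stickRemainder v n := by
    rw [stickRemainder_eq_prod]
    exact Finset.prod_nonneg fun k _ => by linarith [(hv k).2]
  have h1 : stickRemainder v n ≤ 1 := by
    rw [stickRemainder_eq_prod]
    exact Finset.prod_le_one (fun k _ => by linarith [(hv k).2]) fun k _ => by linarith [(hv k).1]
  exact ⟨mul_nonneg (hv n).1.le h0, mul_le_one₀ (hv n).2.le h0 h1⟩

theorem map_eq_restrict_of_isUniform {Ω : Type*} [MeasurableSpace Ω] {P : Measure Ω} {X : Ω → ℝ}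
    (h : pdf.IsUniform X (Set.Ioo 0 1) P volume) :
    P.map X = volume.restrict (Set.Ioo 0 1) := by
  rw [h, ProbabilityTheory.cond]
  simp

theorem integral_rpow_of_isUniform {Ω : Type*} [MeasurableSpace Ω] {P : Measure Ω} {X : Ω → ℝ}
    (hX : Measurable X) (h : pdf.IsUniform X (Set.Ioo 0 1) P volume) {θ : ℝ} (hθ : 0 < θ) :
    ∫ ω, |X ω| ^ θ ∂P = (θ + 1)⁻¹ ∧ ∫ ω, |1 - X ω| ^ θ ∂P = (θ + 1)⁻¹ := by
  have key (g : ℝ → ℝ) (hg : Measurable g) :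
      ∫ ω, |g (X ω)| ^ θ ∂P = ∫ x in (0 : ℝ)..1, |g x| ^ θ := by
    have hm : Measurable fun x => |g x| ^ θ := by fun_prop
    rw [← integral_map (f := fun x => |g x| ^ θ) hX.aemeasurable hm.aestronglyMeasurable,
      map_eq_restrict_of_isUniform h, intervalIntegral.integral_of_le zero_le_one,
      integral_Ioc_eq_integral_Ioo]
  have h1 : ∫ x in (0 : ℝ)..1, |x| ^ θ = (θ + 1)⁻¹ := by
    have e : ∫ x in (0 : ℝ)..1, |x| ^ θ = ∫ x in (0 : ℝ)..1, x ^ θ :=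
      intervalIntegral.integral_congr fun x hx => by
        rw [Set.uIcc_of_le zero_le_one] at hx
        simp only [abs_of_nonneg hx.1]
    rw [e, integral_rpow (Or.inl (by linarith)), Real.one_rpow, Real.zero_rpow (by linarith)]
    simp
  refine ⟨(key (fun x => x) measurable_id).trans h1, ?_⟩
  rw [key (fun x => 1 - x) (by fun_prop),
    intervalIntegral.integral_comp_sub_left (fun x => |x| ^ θ) 1]
  simpa using h1

/-- The length is `V n` times the `n` factors `1 - V k`. All `n + 1` factors are independent and
uniform, each with `θ`-moment `(θ + 1)⁻¹`. -/
theorem integral_stickLength_rpow {Ω : Type*} [MeasurableSpace Ω] {P : Measure Ω} {V : ℕ → Ω → ℝ}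
    (hV : ∀ n, Measurable (V n)) (hind : iIndepFun V P)
    (hu : ∀ n, pdf.IsUniform (V n) (Set.Ioo 0 1) P volume) {θ : ℝ} (hθ : 0 < θ) (n : ℕ) :
    ∫ ω, |stickLength (fun k => V k ω) n| ^ θ ∂P = (θ + 1)⁻¹ ^ (n + 1) := by
  let g : ℕ → ℝ → ℝ := fun k v => if k < n then |1 - v| ^ θ else |v| ^ θ
  have hg (k : ℕ) : Measurable (g k) := by
    by_cases hk : k < n <;> simp only [g, hk, if_true, if_false] <;> fun_prop
  have e (ω : Ω) : |stickLength (fun k => V k ω) n| ^ θ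
      = ∏ k ∈ Finset.range (n + 1), g k (V k ω) := by
    rw [Finset.prod_range_succ, stickLength, stickRemainder_eq_prod, abs_mul, Finset.abs_prod,
      Real.mul_rpow (abs_nonneg _) (by positivity), ← Real.finsetProd_rpow _ _ (by simp), mul_comm]
    congr 1
    · exact Finset.prod_congr rfl fun k hk => by simp [g, Finset.mem_range.1 hk]
    · simp [g]
  have hc := (hind.precomp (g := fun i : Finset.range (n + 1) => (i : ℕ))
    Subtype.val_injective).comp (fun i => g i) (fun i => hg i)
  have h1 := hc.integral_fun_prod_eq_prod_integral
    (fun i => ((hg i).comp (hV i)).aestronglyMeasurable)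
  simp only [Function.comp] at h1
  simp only [e]
  have e2 (ω : Ω) : ∏ k ∈ Finset.range (n + 1), g k (V k ω)
      = ∏ k : Finset.range (n + 1), g k (V k ω) :=
    (Finset.prod_coe_sort _ (fun k => g k (V k ω))).symm
  simp only [e2]
  rw [h1, Finset.prod_coe_sort _ (fun k => ∫ ω, g k (V k ω) ∂P)]
  have e3 (k : ℕ) : ∫ ω, g k (V k ω) ∂P = (θ + 1)⁻¹ := by
    by_cases hk : k < n
    · simp only [g, hk, if_true]; exact (integral_rpow_of_isUniform (hV k) (hu k) hθ).2
    · simp only [g, hk, if_false]; exact (integral_rpow_of_isUniform (hV k) (hu k) hθ).1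
  simp [e3]

theorem hasSum_inv_add_one_pow {θ : ℝ} (hθ : 0 < θ) :
    HasSum (fun n : ℕ => (θ + 1)⁻¹ ^ (n + 1)) (1 / θ) := by
  have h := (hasSum_geometric_of_lt_one (r := (θ + 1)⁻¹) (by positivity)
    (inv_lt_one_of_one_lt₀ (by linarith))).mul_left (θ + 1)⁻¹
  have e : (θ + 1)⁻¹ * (1 - (θ + 1)⁻¹)⁻¹ = 1 / θ := by
    have : θ + 1 ≠ 0 := by positivity
    have h2 : 1 - (θ + 1)⁻¹ = θ / (θ + 1) := by field_simp; ring
    rw [h2]; field_simp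
  rw [e] at h
  simpa only [pow_succ'] using h

/-! ### Tail of the stick-breaking series -/

theorem sqrt_rpow_eq {α x : ℝ} (hx : 0 ≤ x) : (√x) ^ α = x ^ (α / 2) := by
  rw [Real.sqrt_eq_rpow, ← Real.rpow_mul hx]; congr 1; ring

theorem proposition1 {Ω : Type*} [MeasurableSpace Ω] (P : Measure Ω) [IsProbabilityMeasure P]
    (α : ℝ) (hα₁ : 1 < α) (hα₂ : α < 2)
    (ℓ : ℕ → Ω → ℝ) (hℓ : IsUniformStickBreaking P ℓ)
    (ν : Measure ℝ) (hν : IsStableLaw α ν)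
    (S : ℕ → Ω → ℝ) (hS_meas : ∀ n, Measurable (S n))
    (hS_law : ∀ n, P.map (S n) = ν) (hS_indep : iIndepFun S P)
    (hℓS : IndepFun (fun ω n => ℓ n ω) (fun ω n => S n ω) P) :
    (∀ᵐ ω ∂P, Summable (fun n => (ℓ n ω) ^ (2 / α - 1) * (S n ω) ^ 2)) ∧
    ∃ cp cm : ℝ, 0 ≤ cp ∧ 0 ≤ cm ∧ 0 < cp + cm ∧
      Tendsto (fun x : ℝ => P.real {ω | √x < S 0 ω} / x ^ (-α / 2)) atTop (𝓝 cp) ∧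
      Tendsto (fun x : ℝ => P.real {ω | √x < -S 0 ω} / x ^ (-α / 2)) atTop (𝓝 cm) ∧
      Tendsto (fun x : ℝ => P.real {ω | x < stickSeries α ℓ S ω} / P.real {ω | x < (S 0 ω) ^ 2})
        atTop (𝓝 (2 ^ (1 - α / 2) / (2 - α))) ∧
      Tendsto (fun x : ℝ => P.real {ω | x < stickSeries α ℓ S ω} /
          ((cp + cm) * x ^ (-α / 2)))
        atTop (𝓝 (2 ^ (1 - α / 2) / (2 - α))) := by
  obtain ⟨V, hVm, hVind, hVu, hℓV⟩ := hℓ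
  obtain ⟨a, b, ha, hb, hab, hta, htb⟩ := hν.exists_tendsto_tails hα₁ hα₂
  have hα0 : 0 < α := by linarith
  set κ : ℝ := α / 2 with hκ
  have hκ0 : 0 < κ := by positivity
  have hκ1 : κ < 1 := by rw [hκ]; linarith
  set θ : ℝ := 1 - α / 2 with hθ
  have hθ0 : 0 < θ := by linarith
  have hexp0 : 0 < 2 / α - 1 := by rw [sub_pos, lt_div_iff₀ hα0]; linarith
  have hVmem : ∀ᵐ ω ∂P, ∀ n, V n ω ∈ Set.Ioo (0 : ℝ) 1 := by
    rw [ae_all_iff]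
    intro n
    have : ∀ᵐ v ∂(P.map (V n)), v ∈ Set.Ioo (0 : ℝ) 1 := by
      rw [map_eq_restrict_of_isUniform (hVu n)]
      exact ae_restrict_mem measurableSet_Ioo
    exact ae_of_ae_map (hVm n).aemeasurable this
  have hℓmem : ∀ᵐ ω ∂P, ∀ n, ℓ n ω ∈ Set.Icc (0 : ℝ) 1 := by
    filter_upwards [hVmem] with ω hω n
    rw [hℓV]
    exact stickLength_mem_Icc hω n
  have hℓm (n : ℕ) : Measurable (ℓ n) := by
    have : ℓ n = fun ω => V n ω * ∏ k ∈ Finset.range n, (1 - V k ω) := by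
      ext ω; rw [hℓV, stickLength, stickRemainder_eq_prod]
    rw [this]
    exact (hVm n).mul (Finset.measurable_prod _ fun k _ => measurable_const.sub (hVm k))
  -- The lengths lie in `[0, 1]` only almost surely; the absolute value makes the weights
  -- nonnegative everywhere.
  let W : ℕ → Ω → ℝ := fun n ω => |ℓ n ω| ^ (2 / α - 1)
  let T : ℕ → Ω → ℝ := fun n ω => S n ω ^ 2
  have hWm (n : ℕ) : Measurable (W n) := by have := hℓm n; fun_prop
  have hTm (n : ℕ) : Measurable (T n) := (hS_meas n).pow_const 2
  -- The exponents multiply to `(2 / α - 1) * (α / 2) = 1 - α / 2`.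
  have hWκ (n : ℕ) (ω : Ω) : W n ω ^ κ = |ℓ n ω| ^ θ := by
    rw [← Real.rpow_mul (abs_nonneg _)]
    congr 1
    rw [hκ, hθ]; field_simp
  have hSl (A : Set ℝ) (hA : MeasurableSet A) : P.real (S 0 ⁻¹' A) = ν.real A := by
    rw [← hS_law 0, map_measureReal_apply (hS_meas 0) hA]
  have hpos (x : ℝ) : P.real {ω | √x < S 0 ω} = ν.real (Set.Ioi √x) :=
    hSl _ measurableSet_Ioi
  have hneg (x : ℝ) : P.real {ω | √x < -S 0 ω} = ν.real (Set.Iio (-√x)) := by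
    rw [← hSl _ measurableSet_Iio]
    congr 1; ext ω; simp [lt_neg]
  have hta' : Tendsto (fun x : ℝ => x ^ κ * P.real {ω | √x < S 0 ω}) atTop (𝓝 a) := by
    refine (hta.comp Real.tendsto_sqrt_atTop).congr' ?_
    filter_upwards [eventually_ge_atTop 0] with x hx
    rw [Function.comp, sqrt_rpow_eq hx, hpos]
  have htb' : Tendsto (fun x : ℝ => x ^ κ * P.real {ω | √x < -S 0 ω}) atTop (𝓝 b) := by
    refine (htb.comp Real.tendsto_sqrt_atTop).congr' ?_
    filter_upwards [eventually_ge_atTop 0] with x hx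
    rw [Function.comp, sqrt_rpow_eq hx, hneg]
  have hsq : Tendsto (fun x : ℝ => x ^ κ * P.real {ω | x < (S 0 ω) ^ 2}) atTop (𝓝 (a + b)) := by
    refine (hta'.add htb').congr' ?_
    filter_upwards [eventually_ge_atTop 0] with x hx
    rw [← mul_add]
    congr 1
    have hset : {ω | x < (S 0 ω) ^ 2} = {ω | √x < S 0 ω} ∪ {ω | √x < -S 0 ω} := by
      ext ω
      simp only [Set.mem_ofPred_eq, Set.mem_union, ← lt_abs]
      rw [Real.sqrt_lt hx (abs_nonneg _), sq_abs]
    rw [hset, measureReal_union]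
    · rw [Set.disjoint_left]
      intro ω h1 h2
      have h3 : √x < S 0 ω := h1
      have h4 : √x < -S 0 ω := h2
      linarith [Real.sqrt_nonneg x]
    · exact measurableSet_lt measurable_const (hS_meas 0).neg
  have hTlaw (n : ℕ) : P.map (T n) = ν.map (fun x => x ^ 2) := by
    rw [← hS_law n, Measure.map_map (by fun_prop) (hS_meas n)]
    rfl
  have hτ : Tendsto (fun x : ℝ => x ^ κ * (ν.map (fun x => x ^ 2)).real (Set.Ioi x)) atTop
      (𝓝 (a + b)) := by
    refine hsq.congr fun x => ?_
    rw [← hTlaw 0, map_measureReal_apply (hTm 0) measurableSet_Ioi]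
    rfl
  have hTind : iIndepFun T P := hS_indep.comp (fun _ x => x ^ 2) (fun _ => by fun_prop)
  have hWT : IndepFun (fun ω n => W n ω) (fun ω n => T n ω) P := by
    have h1 : Measurable fun (l : ℕ → ℝ) (n : ℕ) => |l n| ^ (2 / α - 1) :=
      measurable_pi_lambda _ fun n => by fun_prop
    have h2 : Measurable fun (s : ℕ → ℝ) (n : ℕ) => s n ^ 2 :=
      measurable_pi_lambda _ fun n => by fun_prop
    exact hℓS.comp h1 h2
  obtain ⟨hsum, htail⟩ := weighted_sum_tail (P := P) (W := W) (T := T) (K := 1 / θ) hκ0 hκ1 hab.le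
    hWm hTm (fun n ω => by positivity)
    (by
      filter_upwards [hℓmem] with ω hω n
      have := hω n
      exact Real.rpow_le_one (abs_nonneg _) (by rw [abs_of_nonneg this.1]; exact this.2) hexp0.le)
    (fun n ω => sq_nonneg _) hTlaw hTind hWT hτ
    (fun n => by
      simp only [hWκ]
      refine (integrable_const (1 : ℝ)).mono' 
        (by have := hℓm n; fun_prop : Measurable _).aestronglyMeasurable ?_
      filter_upwards [hℓmem] with ω hω
      rw [Real.norm_of_nonneg (by positivity), abs_of_nonneg (hω n).1]
      exact Real.rpow_le_one (hω n).1 (hω n).2 hθ0.le)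
    (by
      simp only [hWκ, hℓV, integral_stickLength_rpow hVm hVind hVu hθ0]
      exact hasSum_inv_add_one_pow hθ0)
  have hWeq : ∀ᵐ ω ∂P, ∀ n, (ℓ n ω) ^ (2 / α - 1) * (S n ω) ^ 2 = W n ω * T n ω := by
    filter_upwards [hℓmem] with ω hω n
    simp only [W, T, abs_of_nonneg (hω n).1]
  -- The prefactor `1 / 2` moves into the threshold `2 * x`, the source of the factor `2 ^ (-κ)`.
  have hQ (x : ℝ) : P.real {ω | x < stickSeries α ℓ S ω}
      = P.real {ω | 2 * x < ∑' n, W n ω * T n ω} := by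
    refine measureReal_congr ?_
    filter_upwards [hWeq] with ω hω
    refine propext ?_
    change x < stickSeries α ℓ S ω ↔ 2 * x < ∑' n, W n ω * T n ω
    simp only [stickSeries, hω]
    constructor <;> intro h <;> linarith
  set R : ℝ := 2 ^ (1 - α / 2) / (2 - α) with hR
  have hQlim : Tendsto (fun x : ℝ => x ^ κ * P.real {ω | x < stickSeries α ℓ S ω}) atTop
      (𝓝 ((a + b) * R)) := by
    have h1 := (htail.comp (tendsto_id.const_mul_atTop (zero_lt_two (α := ℝ)))).const_mul
      ((2 : ℝ) ^ κ)⁻¹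
    have h2p : (0 : ℝ) < 2 ^ κ := by positivity
    have eR : ((2 : ℝ) ^ κ)⁻¹ * ((a + b) * (1 / θ)) = (a + b) * R := by
      have h3 : (2 : ℝ) - α ≠ 0 := by linarith
      have h4 : θ = (2 - α) / 2 := by rw [hθ]; ring
      rw [hR, Real.rpow_sub zero_lt_two, Real.rpow_one, ← hκ, h4]
      field_simp
    rw [eR] at h1
    refine h1.congr' ?_
    filter_upwards [eventually_ge_atTop 0] with x hx
    simp only [Function.comp, id]
    rw [hQ, Real.mul_rpow zero_le_two hx]
    field_simp
  have hdiv {x : ℝ} (hx : 0 < x) (y : ℝ) : y / x ^ (-α / 2) = x ^ κ * y := by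
    rw [neg_div, Real.rpow_neg hx.le, div_inv_eq_mul, mul_comm]
  refine ⟨?_, a, b, ha, hb, hab, ?_, ?_, ?_, ?_⟩
  · filter_upwards [hsum, hWeq] with ω h1 h2
    simpa only [h2] using h1
  · refine hta'.congr' ?_
    filter_upwards [eventually_gt_atTop 0] with x hx
    rw [hdiv hx]
  · refine htb'.congr' ?_
    filter_upwards [eventually_gt_atTop 0] with x hx
    rw [hdiv hx]
  · have h1 := hQlim.div hsq hab.ne'
    rw [mul_div_cancel_left₀ _ hab.ne'] at h1
    refine h1.congr' ?_
    filter_upwards [eventually_gt_atTop 0] with x hx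
    have : x ^ κ ≠ 0 := by positivity
    simp only [Pi.div_apply]
    rw [mul_div_mul_left _ _ this]
  · have h1 := hQlim.div_const (a + b)
    rw [mul_div_cancel_left₀ _ hab.ne'] at h1
    refine h1.congr' ?_
    filter_upwards [eventually_gt_atTop 0] with x hx
    rw [mul_comm (a + b), ← div_div, hdiv hx]
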